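/- Let $n\ge 1$ and let $P_n^\bullet$ be the once-punctured $n$-gon: a closed disc with $n$ marked points $v_0,\dots,v_{n-1}$ on the boundary, in clockwise order with indices modulo $n$, and one marked point $\bullet$ (the puncture) in the interior. The arcs of $P_n^\bullet$, considered up to isotopy, are the spokes $(v_i,\bullet)$ joining a boundary marked point to the puncture, and, for all $i,j$, the arc $(v_i,v_j)$, i.e. the class of non-self-intersecting curves from $v_i$ to $v_j$ that separate $v_{i+1},\dots,v_{j-1}$ from the puncture and from the remaining marked points; here $(v_i,v_{i+1})$ is a boundary edge and $(v_i,v_i)$ is the loop at $v_i$ that goes once around the puncture, with all other boundary marked points on its other side. Two arcs are non-crossing if their isotopy classes have representatives that do not meet except possibly at endpoints. A triangulation of $P_n^\bullet$ is a maximal set of pairwise non-crossing arcs; let $\mathcal T_n^\bullet$ be the set of all triangulations of $P_n^\bullet$. Let $G_n=\langle\sigma\rangle$ be the cyclic group of order $n$ generated by the rotation $\sigma\colon v_i\mapsto v_{i-1}$, acting on $\mathcal T_n^\bullet$. Put $$t_n(q)=\sum_{s=1}^{n}\begin{bmatrix}2n-s-1\\ n-1\end{bmatrix}_q\in\mathbb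 Z[q],\qquad \begin{bmatrix}a\\ b\end{bmatrix}_q=\frac{[a]_q!}{[b]_q!\,[a-b]_q!},\quad [a]_q!=\prod_{i=1}^{a}(1+q+\dots+q^{i-1}).$$ Then the triple $(\mathcal T_n^\bullet,G_n,t_n(q))$ exhibits the cyclic sieving phenomenon: $\mathcal T_n^\bullet$ is finite and, for every primitive $n$-th root of unity $\zeta_n\in\mathbb C$ and every integer $k\ge 0$, $t_n(\zeta_n^k)$ equals the number of triangulations in $\mathcal T_n^\bullet$ fixed by $\sigma^k$. -/

import Mathlib

open Polynomial
open scoped Pointwise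

/-! ## Arcs and triangulations of the once-punctured polygon

The once-punctured polygon with `n` vertices is the closed unit disc in `ℂ` with the boundary marked
points `v_k = exp (-2πik/n)` (so `v_0, v_1, …` run clockwise) and the puncture `0`. Vertex indices
are taken modulo `n`. -/

namespace PuncturedPolygon

/-- The point of the disc at distance `r` from the puncture and at clockwise angle `2πθ/n`.
In particular `polar n 1 k = v_k` for an integer `k`. -/
noncomputable def polar (n : ℕ) (r θ : ℝ) : ℂ :=
  (r : ℂ) * Complex.exp (-(2 * Real.pi * Complex.I * (θ : ℂ) / (n : ℂ)))

/-- The arcs (up to isotopy) of the once-punctured polygon with `n` vertices.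

* `spoke i` is the arc joining `v_i` to the puncture.
* `chord i j` is the arc `(v_i, v_j)` which leaves `v_{i+1}, …, v_{j-1}` on the side without the
  puncture. For `j = i + 1` it is a boundary edge; for `j = i` it is the loop at `v_i` around the
  puncture.

The curves that make up each of these isotopy classes are described by `Represents`. -/
inductive Arc (n : ℕ) : Type
  | spoke (i : ZMod n) : Arc n
  | chord (i j : ZMod n) : Arc n

/-- `Represents n α γ`: the curve `γ : [0,1] → ℂ` is a non-self-intersecting curve in the disc, whose
interior avoids the boundary circle and the puncture, and which belongs to the isotopy class `α`.

Such a curve is `γ t = polar n (r t) (θ t)` with `r` continuous on `[0,1]` and a continuous choice `θ`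
of the clockwise angle, in units of `2π/n` (which need not have a limit at the puncture).
A curve of the class `(v_i, v_j)` runs from `v_i` to `v_j` while the angle goes in total clockwise from
`v_i` to the first following occurrence of `v_j` (a full turn if `i = j`). Any curve from `v_i` to the
puncture is in the class of the spoke at `v_i`. -/
def Represents (n : ℕ) : Arc n → (ℝ → ℂ) → Prop
  | .spoke i, γ => ∃ (r θ : ℝ → ℝ) (a : ℤ),
      (a : ZMod n) = i ∧
      ContinuousOn r (Set.Icc 0 1) ∧ ContinuousOn θ (Set.Ico 0 1) ∧
      r 0 = 1 ∧ r 1 = 0 ∧ θ 0 = a ∧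
      (∀ t ∈ Set.Ioo (0 : ℝ) 1, 0 < r t ∧ r t < 1) ∧
      (∀ t ∈ Set.Icc (0 : ℝ) 1, γ t = polar n (r t) (θ t)) ∧
      Set.InjOn γ (Set.Ioo 0 1)
  | .chord i j, γ => ∃ (r θ : ℝ → ℝ) (a b : ℤ),
      (a : ZMod n) = i ∧ (b : ZMod n) = j ∧ a < b ∧ b ≤ a + n ∧
      ContinuousOn r (Set.Icc 0 1) ∧ ContinuousOn θ (Set.Icc 0 1) ∧
      r 0 = 1 ∧ r 1 = 1 ∧ θ 0 = a ∧ θ 1 = b ∧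
      (∀ t ∈ Set.Ioo (0 : ℝ) 1, 0 < r t ∧ r t < 1) ∧
      (∀ t ∈ Set.Icc (0 : ℝ) 1, γ t = polar n (r t) (θ t)) ∧
      Set.InjOn γ (Set.Ioo 0 1)

/-- Two arcs do not cross if their isotopy classes have representatives which do not meet, except
possibly at their endpoints. -/
def NonCrossing (n : ℕ) (α β : Arc n) : Prop :=
  ∃ γ δ : ℝ → ℂ, Represents n α γ ∧ Represents n β δ ∧
    Disjoint (γ '' Set.Ioo 0 1) (δ '' Set.Ioo 0 1)

/-- A triangulation is a maximal set of pairwise non-crossing arcs. -/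
def IsTriangulation (n : ℕ) (T : Set (Arc n)) : Prop :=
  Maximal (fun S : Set (Arc n) => S.Pairwise (NonCrossing n)) T

/-- The set of all triangulations of the once-punctured polygon with `n` vertices. -/
def Triangulation (n : ℕ) : Type := {T : Set (Arc n) // IsTriangulation n T}

/-! ### The rotation group and its action -/

/-- The rotation `v_i ↦ v_{i-1}`, as a permutation of the vertices. -/
def rotation (n : ℕ) : Equiv.Perm (ZMod n) := Equiv.subRight 1

/-- The group of rotations generated by `v_i ↦ v_{i-1}`. -/
abbrev RotationGroup (n : ℕ) : Subgroup (Equiv.Perm (ZMod n)) := Subgroup.zpowers (rotation n)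

/-- The rotation `v_i ↦ v_{i-1}`, as an element of the rotation group. -/
def sigma (n : ℕ) : RotationGroup n := ⟨rotation n, Subgroup.mem_zpowers _⟩

/-- Rotations act on arcs through their endpoints. -/
instance arcAction (n : ℕ) : MulAction (RotationGroup n) (Arc n) where
  smul g α := match α with
    | .spoke i => .spoke (g.1 i)
    | .chord i j => .chord (g.1 i) (g.1 j)
  one_smul α := by cases α <;> rfl
  mul_smul g h α := by cases α <;> rfl

theorem rotation_zpow_apply (n : ℕ) (k : ℤ) (i : ZMod n) : (rotation n ^ k) i = i - (k : ZMod n) := by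
  induction k using Int.induction_on generalizing i with
  | zero => simp
  | succ k ih =>
    rw [zpow_add_one, Equiv.Perm.mul_apply, ih]
    simp only [rotation, Equiv.subRight_apply]
    push_cast
    ring
  | pred k ih =>
    rw [zpow_sub_one, Equiv.Perm.mul_apply, ih]
    have h : (rotation n)⁻¹ i = i + 1 := by
      rw [Equiv.Perm.inv_eq_iff_eq]
      simp [rotation]
    rw [h]
    push_cast
    ring

theorem polar_sub (n : ℕ) (r θ κ : ℝ) : polar n r (θ - κ) = polar n 1 (-κ) * polar n r θ := by
  simp only [polar]
  rw [Complex.ofReal_one, one_mul, mul_left_comm, ← Complex.exp_add]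
  congr 2
  push_cast
  ring

/-- Rotating a curve rotates the arc that it represents: the action on arcs is the geometric one. -/
theorem Represents.rotate {n : ℕ} {α : Arc n} {γ : ℝ → ℂ} (h : Represents n α γ)
    (g : RotationGroup n) (k : ℤ) (hg : g.1 = rotation n ^ k) :
    Represents n (g • α) (fun t => polar n 1 (-(k : ℝ)) * γ t) := by
  have hne : polar n 1 (-(k : ℝ)) ≠ 0 := by simp [polar, Complex.exp_ne_zero]
  have hgi : ∀ i, g.1 i = i - (k : ZMod n) := fun i => by rw [hg, rotation_zpow_apply]
  cases α with
  | spoke i =>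
    obtain ⟨r, θ, a, ha, hr, hθ, hr0, hr1, hθ0, hrt, hγ, hinj⟩ := h
    refine ⟨r, fun t => θ t - k, a - k, ?_, hr, hθ.sub continuousOn_const, hr0, hr1, ?_, hrt, ?_, ?_⟩
    · rw [hgi, ← ha]; push_cast; ring
    · simp [hθ0]
    · intro t ht
      change _ * γ t = polar n (r t) (θ t - k)
      rw [hγ t ht, polar_sub]
    · exact fun s hs t ht hst => hinj hs ht (mul_left_cancel₀ hne hst)
  | chord i j =>
    obtain ⟨r, θ, a, b, ha, hb, hab, hba, hr, hθ, hr0, hr1, hθ0, hθ1, hrt, hγ, hinj⟩ := h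
    refine ⟨r, fun t => θ t - k, a - k, b - k, ?_, ?_, by omega, by omega, hr,
      hθ.sub continuousOn_const, hr0, hr1, ?_, ?_, hrt, ?_, ?_⟩
    · rw [hgi, ← ha]; push_cast; ring
    · rw [hgi, ← hb]; push_cast; ring
    · simp [hθ0]
    · simp [hθ1]
    · intro t ht
      change _ * γ t = polar n (r t) (θ t - k)
      rw [hγ t ht, polar_sub]
    · exact fun s hs t ht hst => hinj hs ht (mul_left_cancel₀ hne hst)

theorem NonCrossing.rotate {n : ℕ} {α β : Arc n} (h : NonCrossing n α β) (g : RotationGroup n) :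
    NonCrossing n (g • α) (g • β) := by
  obtain ⟨γ, δ, hγ, hδ, hd⟩ := h
  obtain ⟨k, hk⟩ := Subgroup.mem_zpowers_iff.1 g.2
  have hne : polar n 1 (-(k : ℝ)) ≠ 0 := by simp [polar, Complex.exp_ne_zero]
  refine ⟨_, _, hγ.rotate g k hk.symm, hδ.rotate g k hk.symm, ?_⟩
  rw [Set.disjoint_left] at hd ⊢
  rintro _ ⟨s, hs, rfl⟩ ⟨t, ht, hst⟩
  exact hd ⟨s, hs, rfl⟩ ⟨t, ht, mul_left_cancel₀ hne hst⟩

theorem pairwise_rotate {n : ℕ} {S : Set (Arc n)} (h : S.Pairwise (NonCrossing n))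
    (g : RotationGroup n) : (g • S).Pairwise (NonCrossing n) := by
  rintro _ ⟨α, hα, rfl⟩ _ ⟨β, hβ, rfl⟩ hne
  exact (h hα hβ fun e => hne (by rw [e])).rotate g

theorem IsTriangulation.rotate {n : ℕ} {T : Set (Arc n)} (h : IsTriangulation n T)
    (g : RotationGroup n) : IsTriangulation n (g • T) := by
  refine ⟨pairwise_rotate h.1 g, fun S hS hTS => ?_⟩
  have h1 : T ⊆ g⁻¹ • S := Set.subset_smul_set_iff.2 (by simpa using hTS)
  have h2 : g⁻¹ • S ⊆ T := h.2 (pairwise_rotate hS g⁻¹) h1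
  simpa using Set.smul_set_subset_iff_subset_inv_smul_set.1 h2

/-- Rotations act on triangulations by rotating every arc. -/
instance triangulationAction (n : ℕ) : MulAction (RotationGroup n) (Triangulation n) where
  smul g T := ⟨g • T.1, T.2.rotate g⟩
  one_smul T := Subtype.ext (one_smul _ T.1)
  mul_smul g h T := Subtype.ext (mul_smul g h T.1)

end PuncturedPolygon

/-! ## q-analogues -/

/-- The Gaussian binomial coefficient as a polynomial in `q = X`, by the `q`-Pascal rule.
See `qBinom_mul` for the formula through `q`-factorials. -/
noncomputable def qBinom : ℕ → ℕ → ℤ[X]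
  | _, 0 => 1
  | 0, _ + 1 => 0
  | n + 1, k + 1 => qBinom n k + X ^ (k + 1) * qBinom n (k + 1)

/-- The `q`-integer `1 + q + ⋯ + q^(n-1)`. -/
noncomputable def qInt (n : ℕ) : ℤ[X] := ∑ i ∈ Finset.range n, X ^ i

/-- The `q`-factorial. -/
noncomputable def qFactorial (n : ℕ) : ℤ[X] := ∏ i ∈ Finset.range n, qInt (i + 1)

theorem qBinom_eq_zero : ∀ {n k : ℕ}, n < k → qBinom n k = 0
  | 0, _ + 1, _ => by simp [qBinom]
  | n + 1, k + 1, h => by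
    rw [qBinom, qBinom_eq_zero (by omega : n < k), qBinom_eq_zero (by omega : n < k + 1)]
    simp

theorem qInt_add (a b : ℕ) : qInt (a + b) = qInt a + X ^ a * qInt b := by
  simp only [qInt, Finset.sum_range_add, Finset.mul_sum, pow_add]

/-- `[n]! / ([k]! [n-k]!)` is the Gaussian binomial coefficient. -/
theorem qBinom_mul (k l : ℕ) :
    qBinom (k + l) k * (qFactorial k * qFactorial l) = qFactorial (k + l) := by
  have hs : ∀ m, qFactorial (m + 1) = qFactorial m * qInt (m + 1) := fun m =>
    Finset.prod_range_succ _ _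
  induction k generalizing l with
  | zero => simp [qBinom, qFactorial]
  | succ k ihk =>
    induction l with
    | zero =>
      have h := ihk 0
      simp only [add_zero] at h ⊢
      rw [qBinom, qBinom_eq_zero (Nat.lt_succ_self k), hs]
      linear_combination qInt (k + 1) * h
    | succ l ihl =>
      have h1 := ihk (l + 1)
      have e1 : k + 1 + l = k + (l + 1) := by omega
      have e2 : k + 1 + (l + 1) = k + (l + 1) + 1 := by omega
      rw [e1] at ihl
      have h3 : qInt (k + (l + 1) + 1) = qInt (k + 1) + X ^ (k + 1) * qInt (l + 1) := by
        rw [← qInt_add]; congr 1; omega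
      rw [e2, qBinom, hs (k + (l + 1)), h3, mul_add]
      nth_rewrite 1 [← h1]
      rw [← ihl, hs k, hs l]
      ring

/-- `t_{n,s}^{(m)}(q)`, that is `m` times the Gaussian binomial coefficient of `n + n/m - s - 1`
over `n - 1` (used for `m ∣ n` and `1 ≤ s ≤ n/m`, where the subtractions do not truncate). -/
noncomputable def tPolySpokes (m n s : ℕ) : ℤ[X] :=
  (m : ℤ[X]) * qBinom (n + n / m - s - 1) (n - 1)

/-- `t_n(q)`, the sum of `t_{n,s}^{(1)}(q)` over `1 ≤ s ≤ n`. -/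
noncomputable def tPoly (n : ℕ) : ℤ[X] := ∑ s ∈ Finset.Icc 1 n, tPolySpokes 1 n s

/-! ## Cyclic sieving -/

/-- The triple `(Y, G, f)` exhibits the cyclic sieving phenomenon: `G = ⟨σ⟩` is cyclic of order `n`
and acts on the finite set `Y`, and for each primitive `n`-th root of unity `ζ` and each `k`, the value
`f(ζ^k)` is the number of points of `Y` fixed by `σ^k`. -/
structure CyclicSieving (n : ℕ) (Y : Type*) (G : Type*) [Group G] [MulAction G Y] (σ : G)
    (f : ℤ[X]) : Prop where
  finite : Finite Y
  generates : ∀ g : G, g ∈ Subgroup.zpowers σ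
  order : orderOf σ = n
  sieving : ∀ ζ : ℂ, IsPrimitiveRoot ζ n → ∀ k : ℕ,
    Polynomial.aeval (ζ ^ k) f = (Nat.card (MulAction.fixedBy Y (σ ^ k)) : ℂ)

/-! # Cyclic sieving for triangulations of the once-punctured polygon -/

/-! ## Crossing of curves in a strip -/

section Crossing

open Set

/-! Unrolling the angle turns a chord into an integer interval `a < b ≤ a + n`, up to translation by
`n`, and a spoke into an integer. Two chords cross exactly when some lifts interleave, and a chord
crosses a spoke exactly when some lift of the spoke lies strictly inside the interval. One direction
is a winding number argument (`curves_meet`), the other uses parabolas as representatives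
(`parabola_lt`). Triangulations thus become combinatorial (`isTriangulation_iff`).

Let `c i` count the arcs, other than the boundary edge, that start at `v_i`. The walk `W` with steps
`1 - c k` recovers the triangulation: chords are first passages to levels at most `W a + 1`, spokes
are strict records. Such a walk gives a triangulation as soon as its drift `n - ∑ c` is positive
(`isTriangulation_walkArcs`), and every triangulation arises so (`hasChord_walk`,
`exists_previous_spoke`). Hence triangulations correspond to `c : ZMod n → ℕ` with `∑ c < n`, and
rotation shifts `c`.

With `g = n.gcd k`, the sequences fixed by a shift by `k` are those pulled back from `ZMod g`, with
sum less than `g` there; stars and bars counts them. On the other side `ζ ^ k` has order `n / g`,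
and the `q`-Lucas theorem reduces `t_n (ζ ^ k)` to the same sum of binomials. -/

theorem lt_of_continuous_of_ne {u : ℝ → ℝ} (hu : Continuous u) {v : ℝ} (h0 : v < u 0)
    (hne : ∀ s ∈ Icc (0 : ℝ) 1, u s ≠ v) : ∀ s ∈ Icc (0 : ℝ) 1, v < u s := by
  intro s hs
  by_contra! h
  obtain ⟨x, hx, hxv⟩ := intermediate_value_Icc' hs.1 hu.continuousOn (show v ∈ Icc (u s) (u 0) from
    ⟨h, h0.le⟩)
  exact hne x ⟨hx.1, hx.2.trans hs.2⟩ hxv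

/-- A continuous function cannot jump over a gap of forbidden values. The gaps used below are the
angles at which the sine has the wrong sign. -/
theorem le_of_continuous_of_ne_Ioo {u : ℝ → ℝ} (hu : Continuous u) {v w : ℝ} (hvw : v < w)
    (h0 : w ≤ u 0) (hne : ∀ s ∈ Icc (0 : ℝ) 1, ∀ x ∈ Ioo v w, u s ≠ x) :
    ∀ s ∈ Icc (0 : ℝ) 1, w ≤ u s := by
  intro s hs
  by_contra! h
  obtain ⟨x, hx1, hx2⟩ := exists_between (max_lt hvw h)
  have := lt_of_continuous_of_ne hu (hx2.trans_le h0)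
    (fun s hs => hne s hs x ⟨(le_max_left _ _).trans_lt hx1, hx2⟩) s hs
  exact absurd hx1 (not_lt.2 (this.le.trans (le_max_right _ _)))

theorem ge_of_continuous_of_ne_Ioo {u : ℝ → ℝ} (hu : Continuous u) {v w : ℝ} (hvw : v < w)
    (h0 : u 0 ≤ v) (hne : ∀ s ∈ Icc (0 : ℝ) 1, ∀ x ∈ Ioo v w, u s ≠ x) :
    ∀ s ∈ Icc (0 : ℝ) 1, u s ≤ v := by
  intro s hs
  have := le_of_continuous_of_ne_Ioo (u := fun s => - u s) hu.neg (neg_lt_neg hvw) (neg_le_neg h0)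
    (fun s hs x hx h => hne s hs (-x) ⟨by linarith [hx.2], by linarith [hx.1]⟩ (by linarith)) s hs
  linarith

/-- A map from the square to the punctured plane cannot wind around the origin. -/
theorem false_of_winding_square (F : ℝ × ℝ → ℂ) (hF : Continuous F) (hne : ∀ p, F p ≠ 0)
    (hbot : ∀ s ∈ Icc (0 : ℝ) 1, 0 ≤ (F (s, 0)).im)
    (hleft : ∀ t ∈ Icc (0 : ℝ) 1, (F (0, t)).im ≤ 0)
    (hright : ∀ t ∈ Icc (0 : ℝ) 1, (F (1, t)).im ≤ 0)
    (h00 : (F (0, 0)).re < 0) (h10 : 0 < (F (1, 0)).re)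
    (htop : ∀ s ∈ Icc (0 : ℝ) 1, (F (s, 1)).im = 0 → (F (s, 1)).re ≤ 0) : False := by
  have I0 : (0 : ℝ) ∈ Icc (0 : ℝ) 1 := by simp
  have I1 : (1 : ℝ) ∈ Icc (0 : ℝ) 1 := by simp
  -- `L` is a continuous logarithm of `F` and `(L p).im` a continuous argument. It is `π` at the
  -- corner `(0, 0)`, falls to `0` along the bottom, and stays at least `π` on the left side and at
  -- most `0` on the right side.
  obtain ⟨L, ⟨hL0, hL⟩, -⟩ := Complex.isCoveringMapOn_exp.existsUnique_continuousMap_lifts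
    ⟨F, hF⟩ (a₀ := ((0 : ℝ), (0 : ℝ))) (e₀ := Complex.log (F (0, 0))) (Complex.exp_log (hne _))
    (fun p => hne p)
  have hexp : ∀ p, Complex.exp (L p) = F p := fun p => congrFun hL p
  have hre : ∀ p, (F p).re = Real.exp (L p).re * Real.cos (L p).im := fun p => by
    rw [← hexp, Complex.exp_re]
  have him : ∀ p, (F p).im = Real.exp (L p).re * Real.sin (L p).im := fun p => by
    rw [← hexp, Complex.exp_im]
  have hc : Continuous fun p => (L p).im := Complex.continuous_im.comp L.continuous
  have s0 : ∀ p, 0 ≤ (F p).im → 0 ≤ Real.sin (L p).im := fun p h => by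
    rw [him] at h
    exact nonneg_of_mul_nonneg_right h (Real.exp_pos _)
  have s1 : ∀ p, (F p).im ≤ 0 → Real.sin (L p).im ≤ 0 := fun p h => by
    rw [him] at h
    by_contra! h'
    exact absurd h (not_le.2 (mul_pos (Real.exp_pos _) h'))
  have e00 : (L (0, 0)).im = Real.pi := by
    rw [hL0, Complex.log_im, Complex.arg_eq_pi_iff]
    exact ⟨h00, le_antisymm (hleft 0 I0) (hbot 0 I0)⟩
  have pp := Real.pi_pos
  have b1 : ∀ s ∈ Icc (0 : ℝ) 1, (L (s, 0)).im ≤ Real.pi :=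
    ge_of_continuous_of_ne_Ioo (u := fun s => (L (s, 0)).im) (hc.comp (by fun_prop))
      (w := 2 * Real.pi) (by linarith) e00.le (fun s hs x hx h => by
        have := s0 _ (hbot s hs)
        rw [h, ← Real.sin_sub_two_pi] at this
        exact absurd this (not_le.2 (Real.sin_neg_of_neg_of_neg_pi_lt (by linarith [hx.2])
          (by linarith [hx.1]))))
  have b2 : ∀ s ∈ Icc (0 : ℝ) 1, 0 ≤ (L (s, 0)).im :=
    le_of_continuous_of_ne_Ioo (u := fun s => (L (s, 0)).im) (hc.comp (by fun_prop))
      (v := - Real.pi) (by linarith) (by simp only [e00]; exact pp.le) (fun s hs x hx h => by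
        have := s0 _ (hbot s hs)
        rw [h] at this
        exact absurd this (not_le.2 (Real.sin_neg_of_neg_of_neg_pi_lt hx.2 hx.1)))
  have e10 : (L (1, 0)).im = 0 := by
    have h1 : Real.sin (L (1, 0)).im = 0 :=
      le_antisymm (s1 _ (hright 0 I0)) (s0 _ (hbot 1 I1))
    have h2 : 0 < Real.cos (L (1, 0)).im := by
      rw [hre] at h10
      exact pos_of_mul_pos_right h10 (Real.exp_pos _).le
    rcases (b2 1 I1).eq_or_lt with h | h
    · exact h.symm
    rcases (b1 1 I1).eq_or_lt with h' | h'
    · rw [h', Real.cos_pi] at h2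
      linarith
    · exact absurd h1 (Real.sin_pos_of_pos_of_lt_pi h h').ne'
  have b3 : ∀ t ∈ Icc (0 : ℝ) 1, Real.pi ≤ (L (0, t)).im :=
    le_of_continuous_of_ne_Ioo (u := fun t => (L (0, t)).im) (hc.comp (by fun_prop))
      (v := 0) (by linarith) e00.ge (fun s hs x hx h => by
        have := s1 _ (hleft s hs)
        rw [h] at this
        exact absurd this (not_le.2 (Real.sin_pos_of_pos_of_lt_pi hx.1 hx.2)))
  have b4 : ∀ t ∈ Icc (0 : ℝ) 1, (L (1, t)).im ≤ 0 :=
    ge_of_continuous_of_ne_Ioo (u := fun t => (L (1, t)).im) (hc.comp (by fun_prop))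
      (w := Real.pi) (by linarith) e10.le (fun s hs x hx h => by
        have := s1 _ (hright s hs)
        rw [h] at this
        exact absurd this (not_le.2 (Real.sin_pos_of_pos_of_lt_pi hx.1 hx.2)))
  -- Along the top the argument must therefore pass through `0`, where `F` is a positive real,
  -- against `htop`.
  obtain ⟨s, hs, hs0⟩ := intermediate_value_Icc' zero_le_one
    (f := fun s => (L (s, 1)).im) (hc.comp (by fun_prop)).continuousOn
    (show (0 : ℝ) ∈ _ from ⟨b4 1 I1, pp.le.trans (b3 1 I1)⟩)
  have h1 := htop s hs (by rw [him]; simp only at hs0; rw [hs0]; simp)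
  rw [hre] at h1
  simp only at hs0
  rw [hs0, Real.cos_zero, mul_one] at h1
  exact absurd h1 (not_le.2 (Real.exp_pos _))

/-- Clamping the parameter extends curves to the whole line, so that logarithms can be lifted over
the plane. -/
theorem ContinuousOn.comp_clamp {f : ℝ → ℝ} (hf : ContinuousOn f (Icc 0 1)) :
    Continuous fun s => f (max 0 (min 1 s)) :=
  hf.comp_continuous (by fun_prop) fun s =>
    ⟨le_max_left _ _, max_le zero_le_one (min_le_left _ _)⟩

theorem clamp_mem (s : ℝ) : max 0 (min 1 s) ∈ Icc (0 : ℝ) 1 :=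
  ⟨le_max_left _ _, max_le zero_le_one (min_le_left _ _)⟩

theorem clamp_eq {s : ℝ} (hs : s ∈ Icc (0 : ℝ) 1) : max 0 (min 1 s) = s := by
  rw [min_eq_right hs.2, max_eq_right hs.1]

/-- If the curves did not meet, the difference of their positions at times `s` and `t` would be a
nonvanishing map of the square of the kind excluded by `false_of_winding_square`. The second
alternative in `hend` serves spokes, which end above the whole chord when height is `1 - r`. -/
theorem curves_meet {x y x' y' : ℝ → ℝ}
    (hx : ContinuousOn x (Icc 0 1)) (hy : ContinuousOn y (Icc 0 1))
    (hx' : ContinuousOn x' (Icc 0 1)) (hy' : ContinuousOn y' (Icc 0 1))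
    (y0 : y 0 = 0) (y1 : y 1 = 0) (y0' : y' 0 = 0)
    (hpos : ∀ t ∈ Ioo (0 : ℝ) 1, 0 < y t) (hpos' : ∀ t ∈ Ioo (0 : ℝ) 1, 0 < y' t)
    (h0 : x 0 < x' 0) (h1 : x' 0 < x 1)
    (hend : ((y' 1 = 0) ∧ x 1 < x' 1) ∨ ∀ t ∈ Icc (0 : ℝ) 1, y t < y' 1) :
    ∃ s ∈ Ioo (0 : ℝ) 1, ∃ t ∈ Ioo (0 : ℝ) 1, x s = x' t ∧ y s = y' t := by
  by_contra! hno
  have I0 : (0 : ℝ) ∈ Icc (0 : ℝ) 1 := by simp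
  have I1 : (1 : ℝ) ∈ Icc (0 : ℝ) 1 := by simp
  have c0 := clamp_eq I0
  have c1 := clamp_eq I1
  have hy0 : ∀ t ∈ Icc (0 : ℝ) 1, 0 ≤ y t := fun t ht => by
    rcases ht.1.eq_or_lt with h | h
    · rw [← h, y0]
    rcases ht.2.eq_or_lt with h' | h'
    · rw [h', y1]
    exact (hpos t ⟨h, h'⟩).le
  have y1' : 0 ≤ y' 1 := by
    rcases hend with h | h
    · exact h.1.ge
    · exact (hy0 0 I0).trans (h 0 I0).le
  have hy0' : ∀ t ∈ Icc (0 : ℝ) 1, 0 ≤ y' t := fun t ht => by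
    rcases ht.1.eq_or_lt with h | h
    · rw [← h, y0']
    rcases ht.2.eq_or_lt with h' | h'
    · rw [h']; exact y1'
    exact (hpos' t ⟨h, h'⟩).le
  have bdry : ∀ t ∈ Icc (0 : ℝ) 1, t ∉ Ioo (0 : ℝ) 1 → t = 0 ∨ t = 1 := fun t ht h => by
    rcases ht.1.eq_or_lt with h' | h'
    · exact Or.inl h'.symm
    · exact Or.inr (le_antisymm ht.2 (not_lt.1 fun h'' => h ⟨h', h''⟩))
  have hne : ∀ s ∈ Icc (0 : ℝ) 1, ∀ t ∈ Icc (0 : ℝ) 1, x s = x' t → y s = y' t → False := by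
    intro s hs t ht e1 e2
    by_cases ms : s ∈ Ioo (0 : ℝ) 1 <;> by_cases mt : t ∈ Ioo (0 : ℝ) 1
    · exact hno s ms t mt e1 e2
    · have := hpos s ms
      rcases bdry t ht mt with rfl | rfl
      · linarith
      · rcases hend with h | h
        · linarith [h.1]
        · linarith [h s hs]
    · have := hpos' t mt
      rcases bdry s hs ms with rfl | rfl <;> linarith
    · rcases bdry t ht mt with rfl | rfl
      · rcases bdry s hs ms with rfl | rfl <;> linarith
      · rcases hend with h | h
        · rcases bdry s hs ms with rfl | rfl <;> linarith [h.2]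
        · linarith [h s hs]
  refine false_of_winding_square
    (fun p => ((x (max 0 (min 1 p.1)) - x' (max 0 (min 1 p.2)) : ℝ) : ℂ) +
      ((y (max 0 (min 1 p.1)) - y' (max 0 (min 1 p.2)) : ℝ) : ℂ) * Complex.I) ?_ ?_ ?_ ?_ ?_ ?_ ?_ ?_
  · have a1 := hx.comp_clamp.comp (continuous_fst (X := ℝ) (Y := ℝ))
    have a2 := hx'.comp_clamp.comp (continuous_snd (X := ℝ) (Y := ℝ))
    have a3 := hy.comp_clamp.comp (continuous_fst (X := ℝ) (Y := ℝ))
    have a4 := hy'.comp_clamp.comp (continuous_snd (X := ℝ) (Y := ℝ))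
    exact (Complex.continuous_ofReal.comp (a1.sub a2)).add
      ((Complex.continuous_ofReal.comp (a3.sub a4)).mul continuous_const)
  · intro p hp
    have e1 := congrArg Complex.re hp
    have e2 := congrArg Complex.im hp
    exact hne _ (clamp_mem p.1) _ (clamp_mem p.2) (by simp at e1; linarith)
      (by simp at e2; linarith)
  · intro s hs
    have := hy0 s hs
    simp [clamp_eq hs, y0', this]
  · intro s hs
    have := hy0' s hs
    simp [clamp_eq hs, y0, this]
  · intro s hs
    have := hy0' s hs
    simp [clamp_eq hs, y1, this]
  · simpa using h0
  · simpa using h1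
  · intro s hs
    simp only [clamp_eq hs, c1]
    rcases hend with ⟨h, h'⟩ | h
    · intro him
      simp [h] at him
      have : s ∉ Ioo (0 : ℝ) 1 := fun hm => (hpos s hm).ne' him
      rcases bdry s hs this with rfl | rfl <;> simp <;> linarith
    · intro him
      simp at him
      linarith [h s hs]

end Crossing

/-! ## Crossing arcs in terms of lifts of their endpoints -/

namespace PuncturedPolygon

open Set

variable {n : ℕ}

theorem intCast_eq_intCast_iff_exists (a b : ℤ) :
    ((a : ZMod n) = (b : ZMod n)) ↔ ∃ k : ℤ, b = a + k * n := by
  rw [ZMod.intCast_eq_intCast_iff_dvd_sub]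
  constructor
  · rintro ⟨k, hk⟩
    exact ⟨k, by linarith⟩
  · rintro ⟨k, hk⟩
    exact ⟨k, by linarith⟩

/-- The translations of the two ends differ by less than one period, because both intervals have
length in `(0, n]`. -/
theorem lift_eq_of_le {a b a' b' : ℤ} (ha : (a' : ZMod n) = a) (hb : (b' : ZMod n) = b)
    (hab : a < b) (hba : b ≤ a + n) (hab' : a' < b') (hba' : b' ≤ a' + n) :
    ∃ k : ℤ, a' = a + k * n ∧ b' = b + k * n := by
  obtain ⟨k, hk⟩ := (intCast_eq_intCast_iff_exists _ _).1 ha.symm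
  obtain ⟨l, hl⟩ := (intCast_eq_intCast_iff_exists _ _).1 hb.symm
  refine ⟨k, hk, ?_⟩
  have h1 : (l - k) * n < 1 * n := by linarith
  have h2 : (-1) * (n : ℤ) < (l - k) * n := by linarith
  have h3 := lt_of_mul_lt_mul_right h1 (by positivity)
  have h4 := lt_of_mul_lt_mul_right h2 (by positivity)
  have : l = k := by omega
  rw [hl, this]

theorem polar_sub_int_mul (hn : n ≠ 0) (r θ : ℝ) (k : ℤ) :
    polar n r (θ - k * n) = polar n r θ := by
  have hn' : (n : ℂ) ≠ 0 := by exact_mod_cast hn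
  rw [polar, polar]
  congr 1
  rw [Complex.exp_eq_exp_iff_exists_int]
  refine ⟨k, ?_⟩
  push_cast
  field_simp
  ring

theorem eq_of_polar_eq (hn : n ≠ 0) {r θ r' θ' : ℝ} (hr : 0 < r) (hr' : 0 < r')
    (h : polar n r θ = polar n r' θ') : r = r' ∧ ∃ k : ℤ, θ = θ' + k * n := by
  have hn' : (n : ℂ) ≠ 0 := by exact_mod_cast hn
  have hnorm : ∀ {r : ℝ} (θ : ℝ), 0 < r → ‖polar n r θ‖ = r := by
    intro r θ hr
    have : -(2 * Real.pi * Complex.I * (θ : ℂ) / (n : ℂ)) =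
        ((-(2 * Real.pi * θ / n) : ℝ) : ℂ) * Complex.I := by
      push_cast
      ring
    rw [polar, this, norm_mul, Complex.norm_exp_ofReal_mul_I, mul_one, Complex.norm_real,
      Real.norm_of_nonneg hr.le]
  have e : r = r' := by rw [← hnorm θ hr, h, hnorm θ' hr']
  refine ⟨e, ?_⟩
  subst e
  rw [polar, polar] at h
  have h := mul_left_cancel₀ (Complex.ofReal_ne_zero.2 hr.ne') h
  obtain ⟨k, hk⟩ := Complex.exp_eq_exp_iff_exists_int.1 h
  refine ⟨-k, ?_⟩
  have hpi : (2 * Real.pi * Complex.I : ℂ) ≠ 0 := Complex.two_pi_I_ne_zero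
  have : (θ : ℂ) = θ' + ((-k : ℤ) : ℂ) * n := by
    field_simp at hk
    have h2 : (2 * Real.pi * Complex.I : ℂ) * θ = (2 * Real.pi * Complex.I : ℂ) *
        (θ' + ((-k : ℤ) : ℂ) * n) := by
      push_cast
      linear_combination (-2 * Real.pi * Complex.I : ℂ) * hk
    exact mul_left_cancel₀ hpi h2
  exact_mod_cast this

/-! ### Arcs that cross -/

theorem Represents.exists_lift_chord (hn : n ≠ 0) {a b : ℤ} (hab : a < b) (hba : b ≤ a + n)
    {γ : ℝ → ℂ} (h : Represents n (.chord a b) γ) :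
    ∃ r θ : ℝ → ℝ, ContinuousOn r (Icc 0 1) ∧ ContinuousOn θ (Icc 0 1) ∧
      r 0 = 1 ∧ r 1 = 1 ∧ θ 0 = a ∧ θ 1 = b ∧ (∀ t ∈ Ioo (0 : ℝ) 1, 0 < r t ∧ r t < 1) ∧
      (∀ t ∈ Icc (0 : ℝ) 1, γ t = polar n (r t) (θ t)) := by
  obtain ⟨r, θ, a', b', ha, hb, hab', hba', hr, hθ, hr0, hr1, hθ0, hθ1, hrt, hγ, -⟩ := h
  obtain ⟨k, rfl, rfl⟩ := lift_eq_of_le ha hb hab hba hab' hba'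
  refine ⟨r, fun t => θ t - k * n, hr, hθ.sub continuousOn_const, hr0, hr1, ?_, ?_, hrt, ?_⟩
  · simp [hθ0]
  · simp [hθ1]
  · intro t ht
    rw [polar_sub_int_mul hn, hγ t ht]

theorem Represents.exists_lift_spoke (hn : n ≠ 0) {a : ℤ}
    {γ : ℝ → ℂ} (h : Represents n (.spoke a) γ) :
    ∃ r θ : ℝ → ℝ, ContinuousOn r (Icc 0 1) ∧ ContinuousOn θ (Ico 0 1) ∧
      r 0 = 1 ∧ r 1 = 0 ∧ θ 0 = a ∧ (∀ t ∈ Ioo (0 : ℝ) 1, 0 < r t ∧ r t < 1) ∧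
      (∀ t ∈ Icc (0 : ℝ) 1, γ t = polar n (r t) (θ t)) := by
  obtain ⟨r, θ, a', ha, hr, hθ, hr0, hr1, hθ0, hrt, hγ, -⟩ := h
  obtain ⟨k, rfl⟩ := (intCast_eq_intCast_iff_exists _ _).1 ha.symm
  refine ⟨r, fun t => θ t - k * n, hr, hθ.sub continuousOn_const, hr0, hr1, ?_, hrt, ?_⟩
  · simp [hθ0]
  · intro t ht
    rw [polar_sub_int_mul hn, hγ t ht]

theorem NonCrossing.symm {α β : Arc n} (h : NonCrossing n α β) : NonCrossing n β α := by
  obtain ⟨γ, δ, hγ, hδ, hd⟩ := h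
  exact ⟨δ, γ, hδ, hγ, hd.symm⟩

theorem not_nonCrossing_chord_chord (hn : n ≠ 0) {a b c d : ℤ} (hba : b ≤ a + n)
    (hdc : d ≤ c + n) (hac : a < c) (hcb : c < b) (hbd : b < d) :
    ¬ NonCrossing n (.chord a b) (.chord c d) := by
  rintro ⟨γ, δ, hγ, hδ, hdisj⟩
  obtain ⟨r, θ, hr, hθ, hr0, hr1, hθ0, hθ1, hrt, hγ⟩ := hγ.exists_lift_chord hn (hac.trans hcb) hba
  obtain ⟨r', θ', hr', hθ', hr0', hr1', hθ0', hθ1', hrt', hδ⟩ :=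
    hδ.exists_lift_chord hn (hcb.trans hbd) hdc
  obtain ⟨s, hs, t, ht, h1, h2⟩ := curves_meet hθ (continuousOn_const (c := (1 : ℝ)).sub hr) hθ'
    (continuousOn_const (c := (1 : ℝ)).sub hr') (by simp [hr0]) (by simp [hr1]) (by simp [hr0'])
    (fun t ht => sub_pos.2 (hrt t ht).2) (fun t ht => sub_pos.2 (hrt' t ht).2)
    (by rw [hθ0, hθ0']; exact_mod_cast hac) (by rw [hθ1, hθ0']; exact_mod_cast hcb)
    (Or.inl ⟨by simp [hr1'], by rw [hθ1, hθ1']; exact_mod_cast hbd⟩)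
  refine Set.disjoint_left.1 hdisj ⟨s, hs, rfl⟩ ⟨t, ht, ?_⟩
  rw [hγ s (Ioo_subset_Icc_self hs), hδ t (Ioo_subset_Icc_self ht), h1,
    show r s = r' t by simpa using h2]

theorem not_nonCrossing_chord_spoke (hn : n ≠ 0) {a b c : ℤ} (hba : b ≤ a + n)
    (hac : a < c) (hcb : c < b) : ¬ NonCrossing n (.chord a b) (.spoke c) := by
  rintro ⟨γ, δ, hγ, hδ, hdisj⟩
  obtain ⟨r, θ, hr, hθ, hr0, hr1, hθ0, hθ1, hrt, hγ⟩ := hγ.exists_lift_chord hn (hac.trans hcb) hba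
  obtain ⟨r', θ', hr', hθ', hr0', hr1', hθ0', hrt', hδ⟩ := hδ.exists_lift_spoke hn
  have I0 : (0 : ℝ) ∈ Icc (0 : ℝ) 1 := by simp
  -- The angle of a spoke need not converge at the puncture. The spoke is therefore cut at a time
  -- `u` where its radius is half the minimal radius of the chord.
  obtain ⟨m, hm, hmin⟩ := isCompact_Icc.exists_isMinOn ⟨0, I0⟩ hr
  have hm0 : 0 < r m := by
    rcases hm.1.eq_or_lt with h | h
    · rw [← h, hr0]; exact one_pos
    rcases hm.2.eq_or_lt with h' | h'
    · rw [h', hr1]; exact one_pos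
    exact (hrt m ⟨h, h'⟩).1
  have hm1 : r m ≤ 1 := hr0 ▸ hmin I0
  obtain ⟨u, hu, hu'⟩ := intermediate_value_Icc' zero_le_one hr'
    (show r m / 2 ∈ Icc (r' 1) (r' 0) from ⟨by rw [hr1']; positivity, by rw [hr0']; linarith⟩)
  have hu0 : 0 < u := hu.1.lt_of_ne (by rintro rfl; linarith)
  have hu1 : u < 1 := hu.2.lt_of_ne (by rintro rfl; linarith)
  have hmap : MapsTo (fun t => u * t) (Icc (0 : ℝ) 1) (Ico 0 1) := fun t ht =>
    ⟨mul_nonneg hu0.le ht.1, by nlinarith [ht.1, ht.2]⟩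
  have hmap' : MapsTo (fun t => u * t) (Ioo (0 : ℝ) 1) (Ioo 0 1) := fun t ht =>
    ⟨mul_pos hu0 ht.1, by nlinarith [ht.1, ht.2]⟩
  have hc : ContinuousOn (fun t => u * t) (Icc (0 : ℝ) 1) := by fun_prop
  obtain ⟨s, hs, t, ht, h1, h2⟩ := curves_meet hθ (continuousOn_const (c := (1 : ℝ)).sub hr)
    (hθ'.comp hc hmap)
    (continuousOn_const (c := (1 : ℝ)).sub (hr'.comp hc fun t ht => Ico_subset_Icc_self (hmap ht)))
    (by simp [hr0]) (by simp [hr1]) (by simp [hr0'])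
    (fun t ht => sub_pos.2 (hrt t ht).2)
    (fun t ht => by simpa using (hrt' _ (hmap' ht)).2)
    (by simp only [Function.comp, mul_zero]; rw [hθ0, hθ0']; exact_mod_cast hac)
    (by simp only [Function.comp, mul_zero]; rw [hθ1, hθ0']; exact_mod_cast hcb)
    (Or.inr fun t ht => by
      have : r m ≤ r t := hmin ht
      change 1 - r t < 1 - r' (u * 1)
      rw [mul_one, hu']
      linarith)
  refine Set.disjoint_left.1 hdisj ⟨s, hs, rfl⟩ ⟨u * t, hmap' ht, ?_⟩
  rw [hγ s (Ioo_subset_Icc_self hs), hδ _ (Ioo_subset_Icc_self (hmap' ht)), h1]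
  have : r s = r' (u * t) := by simpa using h2
  rw [this]
  rfl

/-! ### Arcs that do not cross -/

/-- The standard representative of the arc `(v_a, v_b)`, parametrized by the angle. -/
noncomputable def chordCurve (n : ℕ) (a b : ℤ) (t : ℝ) : ℂ :=
  polar n (1 - ((t * (b - a)) * ((1 - t) * (b - a))) / (n ^ 2 + 1)) (a + t * (b - a))

/-- Both factors of the numerator are at most `n`, so the denominator `n ^ 2 + 1` keeps the curve
off the puncture. -/
theorem chordCurve_radius {a b : ℤ} (hab : a < b) (hba : b ≤ a + n) {t : ℝ}
    (ht : t ∈ Ioo (0 : ℝ) 1) :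
    0 < 1 - ((t * ((b : ℝ) - a)) * ((1 - t) * (b - a))) / ((n : ℝ) ^ 2 + 1) ∧
      1 - ((t * ((b : ℝ) - a)) * ((1 - t) * (b - a))) / ((n : ℝ) ^ 2 + 1) < 1 := by
  have h1 : 0 < (b : ℝ) - a := by
    have : (a : ℝ) < b := by exact_mod_cast hab
    linarith
  have h2 : (b : ℝ) - a ≤ n := by
    have : (b : ℝ) ≤ a + n := by exact_mod_cast hba
    linarith
  have ht1 : 0 < 1 - t := by linarith [ht.2]
  have hp : (0 : ℝ) < (n : ℝ) ^ 2 + 1 := by positivity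
  constructor
  · rw [sub_pos, div_lt_one hp]
    have : (t * ((b : ℝ) - a)) * ((1 - t) * (b - a)) ≤ n * n := by
      refine mul_le_mul ?_ ?_ (by positivity) (by positivity)
      · nlinarith [ht.2]
      · nlinarith [ht.1]
    nlinarith
  · have : 0 < (t * ((b : ℝ) - a)) * ((1 - t) * (b - a)) / ((n : ℝ) ^ 2 + 1) :=
      div_pos (mul_pos (mul_pos ht.1 h1) (mul_pos ht1 h1)) hp
    linarith

theorem chordCurve_angle {a b : ℤ} (hab : a < b) {t : ℝ} (ht : t ∈ Ioo (0 : ℝ) 1) :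
    (a : ℝ) < a + t * (b - a) ∧ (a : ℝ) + t * (b - a) < b := by
  have h1 : (a : ℝ) < b := by exact_mod_cast hab
  constructor <;> nlinarith [ht.1, ht.2]

theorem represents_chordCurve (hn : n ≠ 0) {a b : ℤ} (hab : a < b) (hba : b ≤ a + n) :
    Represents n (.chord a b) (chordCurve n a b) := by
  refine ⟨_, fun t => a + t * (b - a), a, b, rfl, rfl, hab, hba, ?_, by fun_prop, ?_, ?_, by simp,
    by simp, fun t ht => chordCurve_radius hab hba ht, fun t _ => rfl, ?_⟩
  · fun_prop
  · simp
  · simp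
  · intro s hs t ht hst
    obtain ⟨-, k, hk⟩ := eq_of_polar_eq hn (chordCurve_radius hab hba hs).1
      (chordCurve_radius hab hba ht).1 hst
    have hs' := chordCurve_angle hab hs
    have ht' := chordCurve_angle hab ht
    have h0 : (0 : ℝ) < n := by positivity
    have hba' : (b : ℝ) ≤ a + n := by exact_mod_cast hba
    have k1 : (k : ℝ) * n < 1 * n := by linarith
    have k2 : (-1 : ℝ) * n < k * n := by linarith
    have k1 := lt_of_mul_lt_mul_right k1 h0.le
    have k2 := lt_of_mul_lt_mul_right k2 h0.le
    have k0 : k = 0 := by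
      have : k < 1 := by exact_mod_cast k1
      have : -1 < k := by exact_mod_cast k2
      omega
    subst k0
    have h1 : (a : ℝ) < b := by exact_mod_cast hab
    have : (b : ℝ) - a ≠ 0 := by linarith
    simp at hk
    rcases hk with h | h
    · exact h
    · exact absurd h this

/-- The straight representative of the spoke at `v_a`. -/
noncomputable def spokeCurve (n : ℕ) (a : ℤ) (t : ℝ) : ℂ := polar n (1 - t) a

theorem represents_spokeCurve (hn : n ≠ 0) (a : ℤ) :
    Represents n (.spoke a) (spokeCurve n a) := by
  refine ⟨fun t => 1 - t, fun _ => a, a, rfl, by fun_prop, by fun_prop, by simp, by simp, rfl,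
    fun t ht => ⟨by linarith [ht.2], by linarith [ht.1]⟩, fun t _ => rfl, ?_⟩
  intro s hs t ht hst
  have := (eq_of_polar_eq hn (by linarith [hs.2]) (by linarith [ht.2]) hst).1
  linarith

theorem nonCrossing_spoke_spoke (hn : n ≠ 0) {i j : ZMod n} (hij : i ≠ j) :
    NonCrossing n (.spoke i) (.spoke j) := by
  obtain ⟨a, rfl⟩ := ZMod.intCast_surjective i
  obtain ⟨b, rfl⟩ := ZMod.intCast_surjective j
  refine ⟨_, _, represents_spokeCurve hn a, represents_spokeCurve hn b, ?_⟩
  rw [Set.disjoint_left]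
  rintro _ ⟨s, hs, rfl⟩ ⟨t, ht, hst⟩
  obtain ⟨-, k, hk⟩ := eq_of_polar_eq hn (by linarith [ht.2]) (by linarith [hs.2]) hst
  exact hij ((intCast_eq_intCast_iff_exists _ _).2 ⟨k, by exact_mod_cast hk⟩)

theorem nonCrossing_chord_spoke (hn : n ≠ 0) {a b c : ℤ} (hab : a < b) (hba : b ≤ a + n)
    (h : ∀ k : ℤ, ¬ (a < c + k * n ∧ c + k * n < b)) :
    NonCrossing n (.chord a b) (.spoke c) := by
  refine ⟨_, _, represents_chordCurve hn hab hba, represents_spokeCurve hn c, ?_⟩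
  rw [Set.disjoint_left]
  rintro _ ⟨s, hs, rfl⟩ ⟨t, ht, hst⟩
  obtain ⟨-, k, hk⟩ := eq_of_polar_eq hn (chordCurve_radius hab hba hs).1 (by linarith [ht.2])
    hst.symm
  have := chordCurve_angle hab hs
  rw [hk] at this
  exact h k (by exact_mod_cast this)

/-- The standard chords have heights `(x - a) * (b - x)` up to one common factor, so nested
intervals give curves that are disjoint over the smaller open interval. -/
theorem parabola_lt {a b c d x : ℝ} (hac : a ≤ c) (hdb : d ≤ b) (h : a < c ∨ d < b)
    (hcx : c < x) (hxd : x < d) : (x - c) * (d - x) < (x - a) * (b - x) := by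
  rcases h with h | h
  · exact mul_lt_mul (by linarith) (by linarith) (by linarith) (by linarith)
  · exact mul_lt_mul' (by linarith) (by linarith) (by linarith) (by linarith)

theorem nonCrossing_chord_chord (hn : n ≠ 0) {a b c d : ℤ} (hab : a < b) (hba : b ≤ a + n)
    (hcd : c < d) (hdc : d ≤ c + n)
    (h1 : ∀ k : ℤ, ¬ (a < c + k * n ∧ c + k * n < b ∧ b < d + k * n))
    (h2 : ∀ k : ℤ, ¬ (c + k * n < a ∧ a < d + k * n ∧ d + k * n < b))
    (hne : ∀ k : ℤ, ¬ (c + k * n = a ∧ d + k * n = b)) :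
    NonCrossing n (.chord a b) (.chord c d) := by
  refine ⟨_, _, represents_chordCurve hn hab hba, represents_chordCurve hn hcd hdc, ?_⟩
  rw [Set.disjoint_left]
  rintro _ ⟨s, hs, rfl⟩ ⟨t, ht, hst⟩
  obtain ⟨hr, k, hk⟩ := eq_of_polar_eq hn (chordCurve_radius hab hba hs).1
    (chordCurve_radius hcd hdc ht).1 hst.symm
  have h3 := chordCurve_angle hab hs
  have h4 := chordCurve_angle hcd ht
  have hp : (n : ℝ) ^ 2 + 1 ≠ 0 := by positivity
  have hr : (s * ((b : ℝ) - a)) * ((1 - s) * (b - a)) = (t * ((d : ℝ) - c)) * ((1 - t) * (d - c)) := by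
    have := sub_right_injective hr
    rwa [div_left_inj' hp] at this
  set x : ℝ := a + s * (b - a) with hx
  have e1 : (s * ((b : ℝ) - a)) * ((1 - s) * (b - a)) = (x - a) * (b - x) := by rw [hx]; ring
  have e2 : (t * ((d : ℝ) - c)) * ((1 - t) * (d - c)) =
      (x - (c + k * n : ℤ)) * ((d + k * n : ℤ) - x) := by rw [hk]; push_cast; ring
  rw [e1, e2] at hr
  have h4 : ((c + k * n : ℤ) : ℝ) < x ∧ x < ((d + k * n : ℤ) : ℝ) := by
    push_cast
    constructor <;> linarith [h4.1, h4.2]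
  specialize h1 k
  specialize h2 k
  specialize hne k
  generalize c + k * n = c' at *
  generalize d + k * n = d' at *
  have i1 : a < d' := by exact_mod_cast h3.1.trans h4.2
  have i2 : c' < b := by exact_mod_cast h4.1.trans h3.2
  -- Overlapping intervals that neither interleave nor coincide are nested, with at least one end
  -- strict.
  have hcase : (a ≤ c' ∧ d' ≤ b ∧ (a < c' ∨ d' < b)) ∨ (c' ≤ a ∧ b ≤ d' ∧ (c' < a ∨ b < d')) := by
    omega
  rcases hcase with ⟨p1, p2, p3⟩ | ⟨p1, p2, p3⟩
  · exact absurd hr (parabola_lt (by exact_mod_cast p1) (by exact_mod_cast p2)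
      (by exact_mod_cast p3) h4.1 h4.2).ne'
  · exact absurd hr (parabola_lt (by exact_mod_cast p1) (by exact_mod_cast p2)
      (by exact_mod_cast p3) h3.1 h3.2).ne

end PuncturedPolygon

/-! ## Triangulations in terms of lifts of the endpoints -/

namespace PuncturedPolygon

variable {n : ℕ}

/-- The integers `a < b ≤ a + n` are lifts of the endpoints of an arc `(v_a, v_b)` of `T`. -/
def HasChord (T : Set (Arc n)) (a b : ℤ) : Prop :=
  a < b ∧ b ≤ a + n ∧ Arc.chord (a : ZMod n) b ∈ T

/-- The spoke at `v_a` belongs to `T`. -/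
def HasSpoke (T : Set (Arc n)) (a : ℤ) : Prop := Arc.spoke (a : ZMod n) ∈ T

theorem intCast_add_mul (a k : ℤ) : ((a + k * n : ℤ) : ZMod n) = a := by simp

theorem HasChord.add_mul {T : Set (Arc n)} {a b : ℤ} (h : HasChord T a b) (k : ℤ) :
    HasChord T (a + k * n) (b + k * n) := by
  refine ⟨by linarith [h.1], by linarith [h.2.1], ?_⟩
  rw [intCast_add_mul, intCast_add_mul]
  exact h.2.2

theorem HasSpoke.add_mul {T : Set (Arc n)} {a : ℤ} (h : HasSpoke T a) (k : ℤ) :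
    HasSpoke T (a + k * n) := by
  rw [HasSpoke, intCast_add_mul]
  exact h

theorem exists_lift (hn : n ≠ 0) (i j : ZMod n) :
    ∃ a b : ℤ, (a : ZMod n) = i ∧ (b : ZMod n) = j ∧ a < b ∧ b ≤ a + n := by
  obtain ⟨a, rfl⟩ := ZMod.intCast_surjective i
  obtain ⟨b, rfl⟩ := ZMod.intCast_surjective j
  have hn' : (0 : ℤ) < n := by omega
  refine ⟨a, a + 1 + (b - a - 1) % n, rfl, ?_, ?_, ?_⟩
  · push_cast [ZMod.intCast_mod]
    ring
  · linarith [Int.emod_nonneg (b - a - 1) hn'.ne']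
  · linarith [Int.emod_lt_of_pos (b - a - 1) hn']

theorem pairwise_nonCrossing_iff (hn : n ≠ 0) (T : Set (Arc n)) :
    T.Pairwise (NonCrossing n) ↔
      (∀ a b c d, HasChord T a b → HasChord T c d → ¬ (a < c ∧ c < b ∧ b < d)) ∧
      (∀ a b c, HasChord T a b → HasSpoke T c → ¬ (a < c ∧ c < b)) := by
  constructor
  · intro h
    refine ⟨fun a b c d hab hcd hx => ?_, fun a b c hab hc hx => ?_⟩
    · refine not_nonCrossing_chord_chord hn hab.2.1 hcd.2.1 hx.1 hx.2.1 hx.2.2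
        (h hab.2.2 hcd.2.2 fun e => ?_)
      -- `Pairwise` says nothing about an arc and itself; but a translate by `k * n` with `0 < k * n
      -- < n` does not exist, so no arc interleaves with its own translate.
      rw [Arc.chord.injEq] at e
      obtain ⟨k, hk, -⟩ := lift_eq_of_le e.1.symm e.2.symm hab.1 hab.2.1 hcd.1 hcd.2.1
      have h1 : (0 : ℤ) * n < k * n := by linarith [hx.1]
      have h2 : k * n < 1 * (n : ℤ) := by linarith [hx.2.1, hab.2.1]
      have h1 := lt_of_mul_lt_mul_right h1 (by positivity)
      have h2 := lt_of_mul_lt_mul_right h2 (by positivity)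
      omega
    · exact not_nonCrossing_chord_spoke hn hab.2.1 hx.1 hx.2 (h hab.2.2 hc (by simp))
  · rintro ⟨h1, h2⟩ α hα β hβ hne
    have key : ∀ i j k, Arc.chord i j ∈ T → Arc.spoke k ∈ T →
        NonCrossing n (.chord i j) (.spoke k) := by
      intro i j k hα hβ
      obtain ⟨a, b, rfl, rfl, hab, hba⟩ := exists_lift hn i j
      obtain ⟨c, rfl⟩ := ZMod.intCast_surjective k
      have hC : HasSpoke T c := hβ
      exact nonCrossing_chord_spoke hn hab hba fun k => h2 _ _ _ ⟨hab, hba, hα⟩ (hC.add_mul k)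
    cases α with
    | spoke i =>
      cases β with
      | spoke j => exact nonCrossing_spoke_spoke hn (by simpa using hne)
      | chord k l => exact (key _ _ _ hβ hα).symm
    | chord i j =>
      cases β with
      | spoke k => exact key _ _ _ hα hβ
      | chord k l =>
        obtain ⟨a, b, rfl, rfl, hab, hba⟩ := exists_lift hn i j
        obtain ⟨c, d, rfl, rfl, hcd, hdc⟩ := exists_lift hn k l
        have A : HasChord T a b := ⟨hab, hba, hα⟩
        have C : HasChord T c d := ⟨hcd, hdc, hβ⟩
        refine nonCrossing_chord_chord hn hab hba hcd hdc (fun k => h1 _ _ _ _ A (C.add_mul k))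
          (fun k => h1 _ _ _ _ (C.add_mul k) A) fun k hk => hne ?_
        rw [← hk.1, ← hk.2, intCast_add_mul, intCast_add_mul]

instance : Std.Symm (NonCrossing n) := ⟨fun _ _ => NonCrossing.symm⟩

/-- Maximality becomes two closure rules: an arc compatible with all arcs of `T` lies in `T`. Since
`HasChord` and `HasSpoke` are periodic, one lift of the new arc suffices. -/
theorem isTriangulation_iff (hn : n ≠ 0) (T : Set (Arc n)) :
    IsTriangulation n T ↔
      (∀ a b c d, HasChord T a b → HasChord T c d → ¬ (a < c ∧ c < b ∧ b < d)) ∧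
      (∀ a b c, HasChord T a b → HasSpoke T c → ¬ (a < c ∧ c < b)) ∧
      (∀ a b : ℤ, a < b → b ≤ a + n →
        (∀ c d, HasChord T c d → ¬ (a < c ∧ c < b ∧ b < d) ∧ ¬ (c < a ∧ a < d ∧ d < b)) →
        (∀ c, HasSpoke T c → ¬ (a < c ∧ c < b)) → HasChord T a b) ∧
      (∀ c, (∀ a b, HasChord T a b → ¬ (a < c ∧ c < b)) → HasSpoke T c) := by
  constructor
  · intro h
    obtain ⟨h1, h2⟩ := (pairwise_nonCrossing_iff hn T).1 h.1
    refine ⟨h1, h2, fun a b hab hba hC hS => ⟨hab, hba, ?_⟩, fun c hC => ?_⟩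
    · refine h.2 (y := insert (Arc.chord (a : ZMod n) b) T) ?_ (Set.subset_insert _ _)
        (Set.mem_insert _ _)
      refine Set.pairwise_insert_of_symm.2
        ⟨h.1, fun β hβ hne => ?_⟩
      cases β with
      | spoke k =>
        obtain ⟨c, rfl⟩ := ZMod.intCast_surjective k
        have hβ : HasSpoke T c := hβ
        exact nonCrossing_chord_spoke hn hab hba fun k => hS _ (hβ.add_mul k)
      | chord k l =>
        obtain ⟨c, d, rfl, rfl, hcd, hdc⟩ := exists_lift hn k l
        have C : HasChord T c d := ⟨hcd, hdc, hβ⟩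
        refine nonCrossing_chord_chord hn hab hba hcd hdc (fun k => (hC _ _ (C.add_mul k)).1)
          (fun k => (hC _ _ (C.add_mul k)).2) fun k hk => hne ?_
        rw [← hk.1, ← hk.2, intCast_add_mul, intCast_add_mul]
    · refine h.2 (y := insert (Arc.spoke (c : ZMod n)) T) ?_ (Set.subset_insert _ _)
        (Set.mem_insert _ _)
      refine Set.pairwise_insert_of_symm.2
        ⟨h.1, fun β hβ hne => ?_⟩
      cases β with
      | spoke k => exact nonCrossing_spoke_spoke hn (by simpa using hne)
      | chord k l =>
        obtain ⟨a, b, rfl, rfl, hab, hba⟩ := exists_lift hn k l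
        have C : HasChord T a b := ⟨hab, hba, hβ⟩
        refine (nonCrossing_chord_spoke hn hab hba fun k hk => ?_).symm
        refine hC _ _ (C.add_mul (-k)) ⟨by linarith [hk.1], by linarith [hk.2]⟩
  · rintro ⟨h1, h2, h3, h4⟩
    refine ⟨(pairwise_nonCrossing_iff hn T).2 ⟨h1, h2⟩, fun S hS hTS α hα => ?_⟩
    obtain ⟨s1, s2⟩ := (pairwise_nonCrossing_iff hn S).1 hS
    have mC : ∀ {a b}, HasChord T a b → HasChord S a b := fun h => ⟨h.1, h.2.1, hTS h.2.2⟩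
    have mS : ∀ {a}, HasSpoke T a → HasSpoke S a := fun h => hTS h
    cases α with
    | spoke i =>
      obtain ⟨c, rfl⟩ := ZMod.intCast_surjective i
      exact h4 c fun a b hab => s2 a b c (mC hab) hα
    | chord i j =>
      obtain ⟨a, b, rfl, rfl, hab, hba⟩ := exists_lift hn i j
      have A : HasChord S a b := ⟨hab, hba, hα⟩
      exact (h3 a b hab hba (fun c d hcd => ⟨s1 a b c d A (mC hcd), s1 c d a b (mC hcd) A⟩)
        fun c hc => s2 a b c A (mS hc)).2.2

end PuncturedPolygon

/-! ## Triangulations from walks on the integers -/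

namespace PuncturedPolygon

variable {n : ℕ}

/-- A walk on the integers with steps at most `1` and with positive drift `s` over each period `n`. -/
structure IsWalk (n : ℕ) (s : ℤ) (W : ℤ → ℤ) : Prop where
  step : ∀ k, W (k + 1) ≤ W k + 1
  shift : ∀ k, W (k + n) = W k + s
  drift_pos : 0 < s

/-- `b` is a time after `a` at which the walk first reaches a level that is at most `W a + 1`. -/
def WalkChord (W : ℤ → ℤ) (a b : ℤ) : Prop :=
  a < b ∧ (∀ k, a < k → k < b → W k < W b) ∧ W b ≤ W a + 1

/-- `a` is a strict record time of the walk. -/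
def WalkSpoke (W : ℤ → ℤ) (a : ℤ) : Prop := ∀ k, k < a → W k < W a

namespace IsWalk

variable {s : ℤ} {W : ℤ → ℤ}

theorem shift_mul (h : IsWalk n s W) (a m : ℤ) : W (a + m * n) = W a + m * s := by
  induction m using Int.induction_on with
  | zero => simp
  | succ m ih =>
    have := h.shift (a + m * n)
    rw [show a + (m + 1) * (n : ℤ) = a + m * n + n by ring, this, ih]
    ring
  | pred m ih =>
    have := h.shift (a + (-m - 1) * n)
    rw [show a + (-m - 1) * (n : ℤ) + n = a + -m * n by ring, ih] at this
    linarith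

theorem period_pos (h : IsWalk n s W) : (0 : ℤ) < n := by
  rcases Nat.eq_zero_or_pos n with rfl | hn
  · have := h.shift 0
    have := h.drift_pos
    simp at *
    omega
  · exact_mod_cast hn

/-- The positive drift carries the walk to every higher level, and upward steps of at most `1` skip
none. -/
theorem exists_first_passage (h : IsWalk n s W) {a v : ℤ} (hv : W a < v) :
    ∃ b, a < b ∧ W b = v ∧ ∀ k, a ≤ k → k < b → W k < v := by
  have hn := h.period_pos
  have hs := h.drift_pos
  obtain ⟨b, ⟨hab, hb⟩, hmin⟩ := Int.exists_least_of_bdd (P := fun b => a < b ∧ v ≤ W b)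
    ⟨a, fun z hz => hz.1.le⟩ ⟨a + (v - W a) * n, by nlinarith, by rw [h.shift_mul]; nlinarith⟩
  have hlt : ∀ k, a ≤ k → k < b → W k < v := by
    intro k hk hkb
    rcases hk.eq_or_lt with rfl | hk
    · exact hv
    · by_contra! hc
      exact absurd (hmin k ⟨hk, hc⟩) (not_le.2 hkb)
  refine ⟨b, hab, le_antisymm ?_ hb, hlt⟩
  have h1 := h.step (b - 1)
  have h2 := hlt (b - 1) (by omega) (by omega)
  rw [sub_add_cancel] at h1
  omega

/-- One period after `a` the walk is already at height `W a + s ≥ W a + 1 ≥ W b`. -/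
theorem length_le (h : IsWalk n s W) {a b : ℤ} (hab : WalkChord W a b) : b ≤ a + n := by
  by_contra! hlt
  have h1 := hab.2.1 (a + n) (by linarith [h.period_pos]) hlt
  rw [h.shift] at h1
  linarith [hab.2.2, h.drift_pos]

theorem walkChord_add_mul (h : IsWalk n s W) {a b : ℤ} (hab : WalkChord W a b) (m : ℤ) :
    WalkChord W (a + m * n) (b + m * n) := by
  refine ⟨by linarith [hab.1], fun k h1 h2 => ?_, ?_⟩
  · have := hab.2.1 (k - m * n) (by linarith) (by linarith)
    have e := h.shift_mul (k - m * n) m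
    rw [sub_add_cancel] at e
    rw [e, h.shift_mul]
    linarith
  · rw [h.shift_mul, h.shift_mul]
    linarith [hab.2.2]

theorem walkSpoke_add_mul (h : IsWalk n s W) {a : ℤ} (ha : WalkSpoke W a) (m : ℤ) :
    WalkSpoke W (a + m * n) := by
  intro k hk
  have := ha (k - m * n) (by linarith)
  have e := h.shift_mul (k - m * n) m
  rw [sub_add_cancel] at e
  rw [e, h.shift_mul]
  linarith

end IsWalk

/-- The set of arcs determined by a walk. -/
def walkArcs (n : ℕ) (W : ℤ → ℤ) : Set (Arc n) :=
  {α | (∃ a : ℤ, WalkSpoke W a ∧ α = .spoke (a : ZMod n)) ∨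
    ∃ a b : ℤ, WalkChord W a b ∧ α = .chord (a : ZMod n) b}

namespace IsWalk

variable {s : ℤ} {W : ℤ → ℤ}

theorem hasChord_walkArcs (h : IsWalk n s W) {a b : ℤ} :
    HasChord (walkArcs n W) a b ↔ WalkChord W a b := by
  constructor
  · rintro ⟨hab, hba, ⟨c, -, hc⟩ | ⟨c, d, hcd, e⟩⟩
    · simp at hc
    · rw [Arc.chord.injEq] at e
      obtain ⟨k, rfl, rfl⟩ := lift_eq_of_le e.1 e.2 hcd.1 (h.length_le hcd) hab hba
      exact h.walkChord_add_mul hcd k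
  · intro hab
    exact ⟨hab.1, h.length_le hab, Or.inr ⟨a, b, hab, rfl⟩⟩

theorem hasSpoke_walkArcs (h : IsWalk n s W) {a : ℤ} :
    HasSpoke (walkArcs n W) a ↔ WalkSpoke W a := by
  constructor
  · rintro (⟨c, hc, e⟩ | ⟨c, d, -, e⟩)
    · rw [Arc.spoke.injEq] at e
      obtain ⟨k, rfl⟩ := (intCast_eq_intCast_iff_exists _ _).1 e.symm
      exact h.walkSpoke_add_mul hc k
    · simp at e
  · intro ha
    exact Or.inl ⟨a, ha, rfl⟩

/-- A time `i` that is not a strict record is thus the end of a walk chord starting at `a`. -/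
theorem exists_last_above (i : ℤ) (h : ∃ k, k < i ∧ W i ≤ W k) :
    ∃ a, a < i ∧ W i ≤ W a ∧ ∀ k, a < k → k < i → W k < W i := by
  obtain ⟨a, ⟨hai, ha⟩, hmax⟩ := Int.exists_greatest_of_bdd (P := fun k => k < i ∧ W i ≤ W k)
    ⟨i, fun z hz => hz.1.le⟩ h
  refine ⟨a, hai, ha, fun k h1 h2 => ?_⟩
  by_contra! hc
  exact absurd (hmax k ⟨h2, hc⟩) (not_le.2 h1)

/-- Crossings would squeeze two levels into one: interleaving chords give `W c < W b < W d ≤ W c +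
1`. For the closure rules, each arc outside the family is blocked by a chord or spoke built from
first passages and last visits. -/
theorem isTriangulation_walkArcs (h : IsWalk n s W) : IsTriangulation n (walkArcs n W) := by
  have hn : n ≠ 0 := by have := h.period_pos; omega
  rw [isTriangulation_iff hn]
  simp only [h.hasChord_walkArcs, h.hasSpoke_walkArcs]
  refine ⟨?_, ?_, ?_, ?_⟩
  · rintro a b c d hab hcd ⟨hac, hcb, hbd⟩
    have h1 := hcd.2.1 b hcb hbd
    have h2 := hab.2.1 c hac hcb
    have h3 := hcd.2.2
    omega
  · rintro a b c hab hc ⟨hac, hcb⟩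
    have h1 := hab.2.1 c hac hcb
    have h2 := hc a hac
    have h3 := hab.2.2
    omega
  · intro a b hab hba hC hS
    -- Otherwise the first passage from an interior maximum `m` to `W m + 1` happens after `b`,
    -- which gives a chord interleaving with `(a, b)`.
    have hlow : ∀ k, a < k → k < b → W k < W b := by
      by_contra! hex
      obtain ⟨k, hak, hkb, hk⟩ := hex
      obtain ⟨m, hm, hmax⟩ := Finset.exists_max_image (Finset.Ioo a b) W
        ⟨k, Finset.mem_Ioo.2 ⟨hak, hkb⟩⟩
      rw [Finset.mem_Ioo] at hm
      obtain ⟨y, hmy, hy, hlt⟩ := h.exists_first_passage (lt_add_one (W m))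
      have hby : b < y := by
        by_contra! hyb
        rcases hyb.eq_or_lt with rfl | hyb
        · have := hmax k (Finset.mem_Ioo.2 ⟨hak, hkb⟩)
          omega
        · have := hmax y (Finset.mem_Ioo.2 ⟨by omega, hyb⟩)
          omega
      exact (hC m y ⟨hmy, fun k h1 h2 => hy ▸ hlt k h1.le h2, hy.le⟩).1 ⟨hm.1, hm.2, hby⟩
    refine ⟨hab, hlow, ?_⟩
    -- The first passage `y` from `a` to `W a + 1` now precedes `b`. It is either a record, giving a
    -- spoke under `(a, b)`, or the end of a chord that starts before `a`.
    by_contra! hb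
    obtain ⟨y, hay, hy, hlt⟩ := h.exists_first_passage (lt_add_one (W a))
    have hyb : y < b := by
      by_contra! hby
      rcases hby.eq_or_lt with rfl | hby
      · omega
      · have := hlt b hab.le hby
        omega
    refine hS y (fun k hk => ?_) ⟨hay, hyb⟩
    by_contra! hc
    obtain ⟨x, hxy, hx, hxlt⟩ := exists_last_above y ⟨k, hk, hc⟩
    have hxa : x < a := by
      by_contra! hax
      have := hlt x hax hxy
      omega
    have hx' : W y ≤ W x + 1 := by omega
    exact (hC x y ⟨hxy, hxlt, hx'⟩).2 ⟨hxa, hay, hyb⟩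
  · intro c hC k hk
    by_contra! hc
    -- The last visit before `c` at height at least `W c` and the first passage after `c` to `W c +
    -- 1` bound a chord over `c`.
    obtain ⟨a, hac, ha, hlt⟩ := exists_last_above c ⟨k, hk, hc⟩
    obtain ⟨b, hcb, hb, hlt'⟩ := h.exists_first_passage (lt_add_one (W c))
    refine hC a b ⟨hac.trans hcb, fun k h1 h2 => ?_, by omega⟩ ⟨hac, hcb⟩
    rcases lt_or_ge k c with h3 | h3
    · have := hlt k h1 h3
      omega
    · have := hlt' k h3 h2
      omega

end IsWalk

open Classical in
/-- The number of arcs of `T`, apart from the boundary edge, that start at `v_a`. -/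
noncomputable def outDegree (T : Set (Arc n)) (a : ℤ) : ℕ :=
  ((Finset.Ioc (a + 1) (a + n)).filter (HasChord T a)).card

theorem outDegree_add (T : Set (Arc n)) (a : ℤ) : outDegree T (a + n) = outDegree T a := by
  classical
  symm
  refine Finset.card_bij (fun b _ => b + n) ?_ ?_ ?_
  · intro b hb
    rw [Finset.mem_filter, Finset.mem_Ioc] at hb ⊢
    refine ⟨⟨by linarith [hb.1.1], by linarith [hb.1.2]⟩, ?_⟩
    simpa using hb.2.add_mul 1
  · intro b _ c _ h
    linarith
  · intro b hb
    rw [Finset.mem_filter, Finset.mem_Ioc] at hb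
    refine ⟨b - n, ?_, by ring⟩
    rw [Finset.mem_filter, Finset.mem_Ioc]
    refine ⟨⟨by linarith [hb.1.1], by linarith [hb.1.2]⟩, ?_⟩
    have := hb.2.add_mul (-1)
    simpa [sub_eq_add_neg] using this

/-- Each level in `(W (a + 1), W a + 1]` is first reached by exactly one chord from `a`; the
boundary edge accounts for the level `W (a + 1)` itself. -/
theorem IsWalk.outDegree_walkArcs {s : ℤ} {W : ℤ → ℤ} (h : IsWalk n s W) (a : ℤ) :
    (outDegree (walkArcs n W) a : ℤ) = W a + 1 - W (a + 1) := by
  classical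
  have key : outDegree (walkArcs n W) a = (Finset.Ioc (W (a + 1)) (W a + 1)).card := by
    refine Finset.card_bij (fun b _ => W b) ?_ ?_ ?_
    · intro b hb
      rw [Finset.mem_filter, Finset.mem_Ioc, h.hasChord_walkArcs] at hb
      exact Finset.mem_Ioc.2 ⟨hb.2.2.1 _ (lt_add_one a) hb.1.1, hb.2.2.2⟩
    · intro b hb c hc hbc
      rw [Finset.mem_filter, Finset.mem_Ioc, h.hasChord_walkArcs] at hb hc
      rcases lt_trichotomy b c with hlt | rfl | hlt
      · exact absurd hbc (hc.2.2.1 b hb.2.1 hlt).ne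
      · rfl
      · exact absurd hbc (hb.2.2.1 c hc.2.1 hlt).ne'
    · intro v hv
      rw [Finset.mem_Ioc] at hv
      obtain ⟨b, hab, rfl, hlt⟩ := h.exists_first_passage hv.1
      have hch : WalkChord W a b :=
        ⟨by omega, fun k h1 h2 => hlt k (by omega) h2, hv.2⟩
      refine ⟨b, ?_, rfl⟩
      rw [Finset.mem_filter, Finset.mem_Ioc, h.hasChord_walkArcs]
      exact ⟨⟨hab, h.length_le hch⟩, hch⟩
  rw [key, Int.card_Ioc, Int.toNat_of_nonneg]
  linarith [h.step a]

/-! ### Every triangulation comes from a walk -/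

section Surjectivity

variable {T : Set (Arc n)}

theorem IsTriangulation.hasChord_succ (hn : n ≠ 0) (h : IsTriangulation n T) (a : ℤ) :
    HasChord T a (a + 1) := by
  obtain ⟨-, -, h3, -⟩ := (isTriangulation_iff hn T).1 h
  exact h3 _ _ (by omega) (by omega) (fun c d _ => by omega) fun c _ => by omega

open Classical in
-- Induction on the length, through the triangle `a, p, b` below the chord, where `p` ends the last
-- shorter chord from `a`. Chords from `p` cannot pass `b`, so `W b = W p + 1`, and `b` adds one
-- chord to those from `a`. No drift is assumed.
theorem IsTriangulation.hasChord_walk (hn : n ≠ 0) (h : IsTriangulation n T) {W : ℤ → ℤ}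
    (hW : ∀ k, W (k + 1) = W k + 1 - outDegree T k) (m : ℕ) : ∀ a b : ℤ, b - a ≤ m →
    HasChord T a b → W b = W (a + 1) + ((Finset.Ioc (a + 1) b).filter (HasChord T a)).card ∧
      ∀ k, a < k → k < b → W k < W b := by
  obtain ⟨h1, h2, h3, -⟩ := (isTriangulation_iff hn T).1 h
  induction m with
  | zero =>
    intro a b hm hab
    have := hab.1
    push_cast at hm
    omega
  | succ m ih =>
    intro a b hm hab
    rcases (Int.add_one_le_iff.2 hab.1).eq_or_lt with rfl | hlt
    · simp only [Finset.Ioc_self, Finset.filter_empty, Finset.card_empty]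
      exact ⟨by simp, fun k h1 h2 => by omega⟩
    obtain ⟨p, ⟨hpb, hap⟩, hmax⟩ := Int.exists_greatest_of_bdd
      (P := fun p => p < b ∧ HasChord T a p) ⟨b, fun z hz => hz.1.le⟩
      ⟨a + 1, hlt, h.hasChord_succ hn a⟩
    -- A chord interleaving with `(p, b)` would cross `(a, b)` or `(a, p)`, or would start at `a`
    -- and contradict the choice of `p`.
    have hpb' : HasChord T p b := by
      refine h3 p b hpb (by linarith [hab.2.1, hap.1]) (fun c d hcd => ⟨fun hx => ?_, fun hx => ?_⟩)
        fun c hc hx => h2 a b c hab hc ⟨hap.1.trans hx.1, hx.2⟩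
      · exact h1 a b c d hab hcd ⟨hap.1.trans hx.1, hx.2.1, hx.2.2⟩
      · rcases lt_trichotomy c a with hca | rfl | hac
        · exact h1 c d a b hcd hab ⟨hca, hap.1.trans hx.2.1, hx.2.2⟩
        · exact absurd (hmax d ⟨hx.2.2, hcd⟩) (not_le.2 hx.2.1)
        · exact h1 a p c d hap hcd ⟨hac, hx.1, hx.2.1⟩
    obtain ⟨e1, l1⟩ := ih a p (by have := hab.1; push_cast at hm; omega) hap
    obtain ⟨e2, l2⟩ := ih p b (by have := hap.1; push_cast at hm; omega) hpb'
    have hdeg : (Finset.Ioc (p + 1) b).filter (HasChord T p) =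
        (Finset.Ioc (p + 1) (p + n)).filter (HasChord T p) := by
      ext x
      simp only [Finset.mem_filter, Finset.mem_Ioc]
      refine ⟨fun hx => ⟨⟨hx.1.1, hx.2.2.1⟩, hx.2⟩, fun hx => ⟨⟨hx.1.1, ?_⟩, hx.2⟩⟩
      by_contra! hbx
      exact h1 a b p x hab hx.2 ⟨hap.1, hpb, hbx⟩
    have hWb : W b = W p + 1 := by
      rw [e2, hdeg, hW p, outDegree]
      ring
    have hins : (Finset.Ioc (a + 1) b).filter (HasChord T a) =
        insert b ((Finset.Ioc (a + 1) p).filter (HasChord T a)) := by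
      ext x
      simp only [Finset.mem_filter, Finset.mem_Ioc, Finset.mem_insert]
      constructor
      · rintro ⟨⟨hx1, hx2⟩, hx⟩
        rcases hx2.eq_or_lt with rfl | hxb
        · exact Or.inl rfl
        · exact Or.inr ⟨⟨hx1, hmax x ⟨hxb, hx⟩⟩, hx⟩
      · rintro (rfl | ⟨⟨hx1, hx2⟩, hx⟩)
        · exact ⟨⟨hlt, le_rfl⟩, hab⟩
        · exact ⟨⟨hx1, hx2.trans hpb.le⟩, hx⟩
    have hnot : b ∉ (Finset.Ioc (a + 1) p).filter (HasChord T a) := by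
      simp only [Finset.mem_filter, Finset.mem_Ioc]
      omega
    refine ⟨?_, fun k hk1 hk2 => ?_⟩
    · rw [hins, Finset.card_insert_of_notMem hnot, hWb, e1]
      push_cast
      ring
    · rcases lt_trichotomy k p with hkp | rfl | hkp
      · have := l1 k hk1 hkp
        omega
      · omega
      · exact l2 k hkp hk2

theorem IsTriangulation.walkChord (hn : n ≠ 0) (h : IsTriangulation n T) {W : ℤ → ℤ}
    (hW : ∀ k, W (k + 1) = W k + 1 - outDegree T k) {a b : ℤ} (hab : HasChord T a b) :
    WalkChord W a b := by
  classical
  obtain ⟨e, l⟩ := h.hasChord_walk hn hW (b - a).toNat a b (Int.self_le_toNat _) hab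
  refine ⟨hab.1, l, ?_⟩
  have : ((Finset.Ioc (a + 1) b).filter (HasChord T a)).card ≤ outDegree T a :=
    Finset.card_le_card (Finset.filter_subset_filter _
      (Finset.Ioc_subset_Ioc le_rfl hab.2.1))
  rw [e, hW]
  omega

/-- Without spokes every vertex lies strictly under a chord. A chord over the left end of another
must contain it, so lengths would grow beyond `n`. -/
theorem IsTriangulation.exists_hasSpoke (hn : n ≠ 0) (h : IsTriangulation n T) :
    ∃ a, HasSpoke T a := by
  obtain ⟨h1, -, -, h4⟩ := (isTriangulation_iff hn T).1 h
  by_contra! hno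
  have hcov : ∀ c, ∃ a b, HasChord T a b ∧ a < c ∧ c < b := fun c => by
    by_contra! hc
    exact hno c (h4 c fun a b hab hx => absurd hx.2 (not_lt.2 (hc a b hab hx.1)))
  have key : ∀ m : ℕ, ∃ a b, HasChord T a b ∧ (m : ℤ) ≤ b - a := by
    intro m
    induction m with
    | zero =>
      obtain ⟨a, b, hab, -, -⟩ := hcov 0
      exact ⟨a, b, hab, by have := hab.1; push_cast; omega⟩
    | succ m ih =>
      obtain ⟨a, b, hab, hm⟩ := ih
      obtain ⟨x, y, hxy, hxa, hay⟩ := hcov a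
      have := h1 x y a b hxy hab
      exact ⟨x, y, hxy, by push_cast; omega⟩
  obtain ⟨a, b, hab, hm⟩ := key (n + 1)
  have := hab.2.1
  push_cast at hm
  omega

/-- The chord between consecutive spokes (a loop if there is only one spoke) crosses nothing in `T`.
The spoke at `i` stops every chord from `j`, so the whole out-degree of `j` is spent by time `i`. -/
theorem IsTriangulation.exists_previous_spoke (hn : n ≠ 0) (h : IsTriangulation n T) {W : ℤ → ℤ}
    (hW : ∀ k, W (k + 1) = W k + 1 - outDegree T k) {i : ℤ} (hi : HasSpoke T i) :
    ∃ j < i, HasSpoke T j ∧ W i = W j + 1 ∧ ∀ k, j < k → k < i → W k < W i := by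
  classical
  obtain ⟨-, h2, h3, -⟩ := (isTriangulation_iff hn T).1 h
  have hprev : HasSpoke T (i - n) := by
    have := hi.add_mul (-1)
    simpa [sub_eq_add_neg] using this
  obtain ⟨j, ⟨hji, hj⟩, hmax⟩ := Int.exists_greatest_of_bdd
    (P := fun j => j < i ∧ HasSpoke T j) ⟨i, fun z hz => hz.1.le⟩ ⟨i - n, by omega, hprev⟩
  have hjn := hmax (i - n) ⟨by omega, hprev⟩
  have hC : HasChord T j i := by
    refine h3 j i hji (by omega) (fun c d hcd => ⟨fun hx => ?_, fun hx => ?_⟩) fun c hc hx => ?_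
    · exact h2 c d i hcd hi ⟨hx.2.1, hx.2.2⟩
    · exact h2 c d j hcd hj ⟨hx.1, hx.2.1⟩
    · exact absurd (hmax c ⟨hx.2, hc⟩) (not_le.2 hx.1)
  obtain ⟨e, l⟩ := h.hasChord_walk hn hW (i - j).toNat j i (Int.self_le_toNat _) hC
  refine ⟨j, hji, hj, ?_, l⟩
  have : (Finset.Ioc (j + 1) i).filter (HasChord T j) =
      (Finset.Ioc (j + 1) (j + n)).filter (HasChord T j) := by
    ext x
    simp only [Finset.mem_filter, Finset.mem_Ioc]
    refine ⟨fun hx => ⟨⟨hx.1.1, hx.2.2.1⟩, hx.2⟩, fun hx => ⟨⟨hx.1.1, ?_⟩, hx.2⟩⟩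
    by_contra! hix
    exact h2 j x i hx.2 hi ⟨hji, hix⟩
  rw [e, this, hW j, outDegree]
  ring

theorem IsTriangulation.walkSpoke (hn : n ≠ 0) (h : IsTriangulation n T) {W : ℤ → ℤ}
    (hW : ∀ k, W (k + 1) = W k + 1 - outDegree T k) {i : ℤ} (hi : HasSpoke T i) :
    WalkSpoke W i := by
  have key : ∀ m : ℕ, ∀ i, HasSpoke T i → ∀ k, k < i → i - k ≤ m → W k < W i := by
    intro m
    induction m with
    | zero =>
      intro i _ k hk hm
      push_cast at hm
      omega
    | succ m ih =>
      intro i hi k hk hm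
      obtain ⟨j, hji, hj, e, l⟩ := h.exists_previous_spoke hn hW hi
      push_cast at hm
      rcases lt_trichotomy k j with hkj | rfl | hkj
      · have := ih j hj k hkj (by omega)
        omega
      · omega
      · exact l k hkj hk
  exact fun k hk => key (i - k).toNat i hi k hk (Int.self_le_toNat _)

theorem IsTriangulation.subset_walkArcs (hn : n ≠ 0) (h : IsTriangulation n T) {W : ℤ → ℤ}
    (hW : ∀ k, W (k + 1) = W k + 1 - outDegree T k) : T ⊆ walkArcs n W := by
  intro α hα
  cases α with
  | spoke i =>
    obtain ⟨a, rfl⟩ := ZMod.intCast_surjective i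
    exact Or.inl ⟨a, h.walkSpoke hn hW hα, rfl⟩
  | chord i j =>
    obtain ⟨a, b, rfl, rfl, hab, hba⟩ := exists_lift hn i j
    exact Or.inr ⟨a, b, h.walkChord hn hW ⟨hab, hba, hα⟩, rfl⟩

end Surjectivity

end PuncturedPolygon

/-! ## Gaussian binomial coefficients at roots of unity -/

section QLucas

/-- The value of a Gaussian binomial coefficient at a complex number. -/
noncomputable def qBinomAt (ζ : ℂ) (a b : ℕ) : ℂ := aeval ζ (qBinom a b)

@[simp]
theorem qBinomAt_zero_right (ζ : ℂ) (a : ℕ) : qBinomAt ζ a 0 = 1 := by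
  cases a <;> simp [qBinomAt, qBinom]

theorem qBinomAt_succ_succ (ζ : ℂ) (a b : ℕ) :
    qBinomAt ζ (a + 1) (b + 1) = qBinomAt ζ a b + ζ ^ (b + 1) * qBinomAt ζ a (b + 1) := by
  simp [qBinomAt, qBinom]

theorem qBinomAt_eq_zero (ζ : ℂ) {a b : ℕ} (h : a < b) : qBinomAt ζ a b = 0 := by
  simp [qBinomAt, qBinom_eq_zero h]

theorem qBinomAt_self (ζ : ℂ) (a : ℕ) : qBinomAt ζ a a = 1 := by
  induction a with
  | zero => simp
  | succ a ih => rw [qBinomAt_succ_succ, ih, qBinomAt_eq_zero ζ (Nat.lt_succ_self a)]; simp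

variable {ζ : ℂ} {m : ℕ}

theorem aeval_qInt_mul (ζ : ℂ) (a : ℕ) : aeval ζ (qInt a) * (ζ - 1) = ζ ^ a - 1 := by
  simpa [qInt] using geom_sum_mul ζ a

theorem IsPrimitiveRoot.aeval_qFactorial_ne_zero (h : IsPrimitiveRoot ζ m) {a : ℕ} (ha : a < m) :
    aeval ζ (qFactorial a) ≠ 0 := by
  rw [qFactorial, map_prod, Finset.prod_ne_zero_iff]
  intro i hi hz
  rw [Finset.mem_range] at hi
  have := aeval_qInt_mul ζ (i + 1)
  rw [hz, zero_mul, eq_comm, sub_eq_zero] at this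
  exact h.pow_ne_one_of_pos_of_lt (by omega) (by omega) this

/-- The `q`-integer of `m` vanishes at `ζ`, while those of smaller positive numbers do not. -/
theorem IsPrimitiveRoot.qBinomAt_order (h : IsPrimitiveRoot ζ m) {j : ℕ} (hj : 0 < j)
    (hjm : j < m) : qBinomAt ζ m j = 0 := by
  have h1 := congrArg (aeval ζ) (qBinom_mul j (m - j))
  rw [Nat.add_sub_cancel' hjm.le, map_mul, map_mul] at h1
  have h2 : aeval ζ (qFactorial m) = 0 := by
    rw [qFactorial, map_prod]
    refine Finset.prod_eq_zero (i := m - 1) (Finset.mem_range.2 (by omega)) ?_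
    rw [Nat.sub_add_cancel (by omega)]
    have h3 := aeval_qInt_mul ζ m
    rw [h.pow_eq_one, sub_self] at h3
    exact (mul_eq_zero.1 h3).resolve_right (sub_ne_zero.2 (h.ne_one (by omega)))
  rw [h2] at h1
  exact (mul_eq_zero.1 h1).resolve_right (mul_ne_zero (h.aeval_qFactorial_ne_zero hjm)
    (h.aeval_qFactorial_ne_zero (by omega)))

theorem IsPrimitiveRoot.qBinomAt_add_of_lt (h : IsPrimitiveRoot ζ m) (a : ℕ) :
    ∀ {b : ℕ}, b < m → qBinomAt ζ (a + m) b = qBinomAt ζ a b := by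
  induction a with
  | zero =>
    intro b hb
    rcases Nat.eq_zero_or_pos b with rfl | hb0
    · simp
    · rw [zero_add, h.qBinomAt_order hb0 hb, qBinomAt_eq_zero ζ hb0]
  | succ a ih =>
    intro b hb
    cases b with
    | zero => simp
    | succ b =>
      rw [add_right_comm, qBinomAt_succ_succ, qBinomAt_succ_succ, ih hb, ih (by omega)]

/-- Row `m` is `1, 0, …, 0, 1`, and since `ζ ^ m = 1` the `q`-Pascal rule propagates it: row `a + m`
is row `a` plus its shift by `m`. -/
theorem IsPrimitiveRoot.qBinomAt_add_add (h : IsPrimitiveRoot ζ m) (hm : 0 < m) (a : ℕ) :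
    ∀ b : ℕ, qBinomAt ζ (a + m) (b + m) = qBinomAt ζ a b + qBinomAt ζ a (b + m) := by
  induction a with
  | zero =>
    intro b
    rw [zero_add, qBinomAt_eq_zero ζ (show 0 < b + m by omega), add_zero]
    rcases Nat.eq_zero_or_pos b with rfl | hb0
    · rw [zero_add, qBinomAt_self, qBinomAt_self]
    · rw [qBinomAt_eq_zero ζ hb0, qBinomAt_eq_zero ζ (by omega)]
  | succ a ih =>
    intro b
    cases b with
    | zero =>
      obtain ⟨l, rfl⟩ : ∃ l, m = l + 1 := ⟨m - 1, by omega⟩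
      have e := ih 0
      rw [zero_add] at e ⊢
      have e2 := h.qBinomAt_add_of_lt a (Nat.lt_succ_self l)
      rw [add_right_comm, qBinomAt_succ_succ, qBinomAt_succ_succ, e, h.pow_eq_one, e2]
      simp
      ring
    | succ b =>
      have e := ih (b + 1)
      rw [add_right_comm b 1 m] at e ⊢
      rw [add_right_comm a 1 m, qBinomAt_succ_succ, qBinomAt_succ_succ, qBinomAt_succ_succ, e, ih]
      rw [show b + m + 1 = (b + 1) + m by omega, pow_add ζ (b + 1) m, h.pow_eq_one]
      ring

/-- The `q`-analogue of Lucas' theorem. -/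
theorem IsPrimitiveRoot.qBinomAt_lucas (h : IsPrimitiveRoot ζ m) {r j : ℕ} (hr : r < m)
    (hj : j < m) (a : ℕ) :
    ∀ b : ℕ, qBinomAt ζ (a * m + r) (b * m + j) = (a.choose b : ℂ) * qBinomAt ζ r j := by
  induction a with
  | zero =>
    intro b
    cases b with
    | zero => simp
    | succ b =>
      rw [qBinomAt_eq_zero ζ (by nlinarith)]
      simp
  | succ a ih =>
    intro b
    rw [show (a + 1) * m + r = a * m + r + m by ring]
    cases b with
    | zero =>
      rw [zero_mul, zero_add, h.qBinomAt_add_of_lt _ hj]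
      simpa using ih 0
    | succ b =>
      have e := ih (b + 1)
      rw [show (b + 1) * m + j = b * m + j + m by ring] at e ⊢
      rw [h.qBinomAt_add_add (by omega), e, ih, Nat.choose_succ_succ]
      push_cast
      ring

/-! ### Evaluation of `t_n` at roots of unity -/

theorem sum_range_mul_of_eq_zero {M : Type*} [AddCommMonoid M] (f : ℕ → M) (hm : 0 < m)
    (hf : ∀ i, ¬ m ∣ i → f i = 0) (N : ℕ) :
    ∑ i ∈ Finset.range (N * m), f i = ∑ u ∈ Finset.range N, f (u * m) := by
  induction N with
  | zero => simp
  | succ N ih =>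
    rw [add_mul, one_mul, Finset.sum_range_add, ih, Finset.sum_range_succ]
    congr 1
    rw [Finset.sum_eq_single_of_mem 0 (Finset.mem_range.2 hm), add_zero]
    intro v hv hv0
    refine hf _ fun hd => ?_
    rw [Nat.dvd_add_right (Nat.dvd_mul_left m N)] at hd
    exact absurd (Nat.le_of_dvd (by omega) hd) (not_le.2 (Finset.mem_range.1 hv))

/-- Put `i = n - s` with `n = N * m`. The lower index `n - 1` has residue `m - 1`, so by `q`-Lucas
only upper indices `n - 1 + i` of the same residue, i.e. `m ∣ i`, contribute. -/
theorem IsPrimitiveRoot.aeval_tPoly (h : IsPrimitiveRoot ζ m) (hm : 0 < m) {N : ℕ} (hN : 0 < N) :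
    aeval ζ (tPoly (N * m)) = ((∑ u ∈ Finset.range N, (N - 1 + u).choose (N - 1) : ℕ) : ℂ) := by
  have hn : 0 < N * m := Nat.mul_pos hN hm
  have e1 : aeval ζ (tPoly (N * m)) =
      ∑ i ∈ Finset.range (N * m), qBinomAt ζ (N * m - 1 + i) (N * m - 1) := by
    rw [tPoly, map_sum]
    refine Finset.sum_nbij' (fun s => N * m - s) (fun i => N * m - i) ?_ ?_ ?_ ?_ ?_
    · intro s hs
      simp only [Finset.mem_Icc, Finset.mem_range] at hs ⊢
      omega
    · intro s hs
      simp only [Finset.mem_Icc, Finset.mem_range] at hs ⊢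
      omega
    · intro s hs
      simp only [Finset.mem_Icc] at hs
      omega
    · intro s hs
      simp only [Finset.mem_range] at hs
      omega
    · intro s hs
      simp only [Finset.mem_Icc] at hs
      simp only [tPolySpokes, Nat.cast_one, one_mul, Nat.div_one, qBinomAt]
      congr 2
      omega
  have hsub : N * m - 1 = (N - 1) * m + (m - 1) := by
    obtain ⟨N, rfl⟩ : ∃ k, N = k + 1 := ⟨N - 1, by omega⟩
    rw [add_mul, Nat.add_sub_cancel]
    omega
  rw [e1, sum_range_mul_of_eq_zero _ hm]
  · push_cast
    refine Finset.sum_congr rfl fun u _ => ?_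
    rw [hsub, show (N - 1) * m + (m - 1) + u * m = (N - 1 + u) * m + (m - 1) by ring,
      h.qBinomAt_lucas (by omega) (by omega), qBinomAt_self, mul_one]
  · intro i hi
    have hi' : 0 < i % m := Nat.pos_of_ne_zero fun h => hi (Nat.dvd_of_mod_eq_zero h)
    have hlt := Nat.mod_lt i hm
    have : N * m - 1 + i = (N + i / m) * m + (i % m - 1) := by
      have := Nat.div_add_mod i m
      have := Nat.mul_comm m (i / m)
      rw [add_mul]
      omega
    rw [this, hsub, h.qBinomAt_lucas (by omega) (by omega),
      qBinomAt_eq_zero ζ (show i % m - 1 < m - 1 by omega), mul_zero]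

end QLucas

/-! ## The rotation action on triangulations -/

theorem ZMod.sum_eq_sum_range {n : ℕ} [NeZero n] {M : Type*} [AddCommMonoid M] (f : ZMod n → M) :
    ∑ x, f x = ∑ i ∈ Finset.range n, f (i : ZMod n) := by
  refine Finset.sum_nbij' (fun x => x.val) (fun i => (i : ZMod n)) ?_ ?_ ?_ ?_ ?_
  · intro x _
    exact Finset.mem_range.2 (ZMod.val_lt x)
  · intro i _
    exact Finset.mem_univ _
  · intro x _
    exact ZMod.natCast_rightInverse x
  · intro i hi
    exact ZMod.val_cast_of_lt (Finset.mem_range.1 hi)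
  · intro x _
    rw [ZMod.natCast_rightInverse x]

namespace PuncturedPolygon

/-- The walk on the integers with `walk f 0 = 0` and with steps `f`. -/
noncomputable def walk (f : ℤ → ℤ) (k : ℤ) : ℤ := ∑ i ∈ Finset.Ico 0 k, f i - ∑ i ∈ Finset.Ico k 0, f i

theorem walk_add_one (f : ℤ → ℤ) (k : ℤ) : walk f (k + 1) = walk f k + f k := by
  rw [walk, walk]
  rcases le_or_gt 0 k with hk | hk
  · rw [← Finset.insert_Ico_right_eq_Ico_add_one hk, Finset.sum_insert Finset.right_notMem_Ico,
      Finset.Ico_eq_empty_of_le hk, Finset.Ico_eq_empty_of_le (by omega : (0 : ℤ) ≤ k + 1)]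
    ring
  · rw [← Finset.insert_Ico_add_one_left_eq_Ico hk, Finset.sum_insert (by simp),
      Finset.Ico_eq_empty_of_le hk.le, Finset.Ico_eq_empty_of_le (by omega : k + 1 ≤ (0 : ℤ))]
    ring

theorem eq_of_add_one_eq {D : ℤ → ℤ} (h : ∀ k, D (k + 1) = D k) (k : ℤ) : D k = D 0 := by
  induction k using Int.induction_on with
  | zero => rfl
  | succ k ih => rw [h, ih]
  | pred k ih =>
    rw [← ih, ← h (-k - 1)]
    congr 1
    ring

variable {n : ℕ}

/-- The walk with steps `1 - c k`. -/
noncomputable def walkOf (c : ZMod n → ℕ) : ℤ → ℤ := walk fun k => 1 - c (k : ZMod n)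

theorem walkOf_add_one (c : ZMod n → ℕ) (k : ℤ) :
    walkOf c (k + 1) = walkOf c k + 1 - c (k : ZMod n) := by
  rw [walkOf, walk_add_one]
  ring

theorem walkOf_zero (c : ZMod n → ℕ) : walkOf c 0 = 0 := by simp [walkOf, walk]

theorem walkOf_natCast (c : ZMod n → ℕ) (m : ℕ) :
    walkOf c m = m - ((∑ i ∈ Finset.range m, c (i : ZMod n) : ℕ) : ℤ) := by
  induction m with
  | zero => simp [walkOf_zero]
  | succ m ih =>
    rw [Nat.cast_succ, walkOf_add_one, ih, Finset.sum_range_succ]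
    push_cast
    ring

theorem walkOf_add_period [NeZero n] (c : ZMod n → ℕ) (k : ℤ) :
    walkOf c (k + n) = walkOf c k + (n - ((∑ x, c x : ℕ) : ℤ)) := by
  have := eq_of_add_one_eq (D := fun k => walkOf c (k + n) - walkOf c k) (fun k => by
    rw [add_right_comm, walkOf_add_one, walkOf_add_one]
    push_cast
    rw [ZMod.natCast_self, add_zero]
    ring) k
  simp only [zero_add] at this
  rw [walkOf_zero, walkOf_natCast, ← ZMod.sum_eq_sum_range] at this
  linarith

theorem isWalk_walkOf [NeZero n] {c : ZMod n → ℕ} (hc : ∑ x, c x < n) :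
    IsWalk n (n - ((∑ x, c x : ℕ) : ℤ)) (walkOf c) where
  step k := by
    rw [walkOf_add_one]
    omega
  shift := walkOf_add_period c
  drift_pos := by omega

theorem walkOf_shift (c : ZMod n → ℕ) (j : ℤ) (k : ℤ) :
    walkOf (fun x : ZMod n => c (x + j)) k = walkOf c (k + j) - walkOf c j := by
  have := eq_of_add_one_eq
    (D := fun k => walkOf (fun x : ZMod n => c (x + j)) k - walkOf c (k + j)) (fun k => by
    rw [add_right_comm, walkOf_add_one, walkOf_add_one]
    push_cast
    ring) k
  simp only [zero_add] at this
  rw [walkOf_zero] at this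
  linarith

/-- The sequences that parametrize the triangulations. -/
abbrev DegreeSequence (n : ℕ) [NeZero n] : Type := {c : ZMod n → ℕ // ∑ x, c x < n}

/-- The triangulation with a given sequence of numbers of arcs that start at each vertex. -/
noncomputable def triangulationOf [NeZero n] (c : DegreeSequence n) : Triangulation n :=
  ⟨walkArcs n (walkOf c.1), (isWalk_walkOf c.2).isTriangulation_walkArcs⟩

theorem triangulationOf_injective [NeZero n] :
    Function.Injective (triangulationOf (n := n)) := by
  intro c c' h
  have h' : walkArcs n (walkOf c.1) = walkArcs n (walkOf c'.1) := congrArg Subtype.val h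
  refine Subtype.ext (funext fun x => ?_)
  obtain ⟨a, rfl⟩ := ZMod.intCast_surjective x
  have e := (isWalk_walkOf c.2).outDegree_walkArcs a
  have e' := (isWalk_walkOf c'.2).outDegree_walkArcs a
  rw [walkOf_add_one] at e e'
  rw [h'] at e
  omega

theorem outDegree_eq_of_intCast_eq (T : Set (Arc n)) {a b : ℤ} (h : (a : ZMod n) = b) :
    outDegree T a = outDegree T b := by
  obtain ⟨k, rfl⟩ := (intCast_eq_intCast_iff_exists _ _).1 h
  have hp : Function.Periodic (outDegree T) (n : ℤ) := outDegree_add T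
  exact (hp.int_mul k a).symm

/-- Take the out-degrees of `T`. A spoke at `i` makes `i + n` a strict record, so the drift is
positive; then `T` lies in the triangulation of its walk, and maximality gives equality. -/
theorem triangulationOf_surjective [NeZero n] :
    Function.Surjective (triangulationOf (n := n)) := by
  rintro ⟨T, hT⟩
  have hn := NeZero.ne n
  let c : ZMod n → ℕ := fun x => outDegree T x.val
  have hc : ∀ a : ℤ, c a = outDegree T a := fun a =>
    outDegree_eq_of_intCast_eq T (by simp)
  have hW : ∀ k, walkOf c (k + 1) = walkOf c k + 1 - outDegree T k := fun k => by
    rw [walkOf_add_one, hc]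
  obtain ⟨i, hi⟩ := hT.exists_hasSpoke hn
  have hi' : HasSpoke T (i + n) := by simpa using hi.add_mul 1
  have hlt := hT.walkSpoke hn hW hi' i (by omega)
  rw [walkOf_add_period] at hlt
  have hsum : ∑ x, c x < n := by omega
  refine ⟨⟨c, hsum⟩, Subtype.ext (Set.Subset.antisymm ?_ (hT.subset_walkArcs hn hW))⟩
  exact hT.2 (isWalk_walkOf hsum).isTriangulation_walkArcs.1 (hT.subset_walkArcs hn hW)

/-! ### Equivariance under rotation -/

theorem sigma_pow_apply (k : ℕ) (i : ZMod n) : ((sigma n) ^ k).1 i = i - k := by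
  have := rotation_zpow_apply n k i
  rw [zpow_natCast, Int.cast_natCast] at this
  rw [SubgroupClass.coe_pow]
  exact this

/-- Shift of a degree sequence. -/
def DegreeSequence.shift [NeZero n] (c : DegreeSequence n) (k : ℕ) : DegreeSequence n :=
  ⟨fun x : ZMod n => c.1 (x + k), by
    have := Equiv.sum_comp (Equiv.addRight (k : ZMod n)) c.1
    exact this.trans_lt c.2⟩

/-- Shifting the sequence translates the time of the walk and changes its values by a constant, to
which chords and records are insensitive. -/
theorem sigma_pow_smul_triangulationOf [NeZero n] (c : DegreeSequence n) (k : ℕ) :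
    (sigma n) ^ k • triangulationOf c = triangulationOf (c.shift k) := by
  refine Subtype.ext ?_
  change (sigma n) ^ k • walkArcs n (walkOf c.1) = walkArcs n (walkOf fun x : ZMod n => c.1 (x + k))
  have hs : ∀ a : ℤ, walkOf (fun x : ZMod n => c.1 (x + k)) a = walkOf c.1 (a + k) - walkOf c.1 k := fun a =>
    by simpa using walkOf_shift c.1 k a
  have spoke : ∀ a, WalkSpoke (walkOf fun x : ZMod n => c.1 (x + k)) a ↔ WalkSpoke (walkOf c.1) (a + k) := by
    intro a
    refine ⟨fun h j hj => ?_, fun h j hj => ?_⟩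
    · have := h (j - k) (by omega)
      rw [hs, hs, sub_add_cancel] at this
      omega
    · have := h (j + k) (by omega)
      rw [hs, hs]
      omega
  have chord : ∀ a b, WalkChord (walkOf fun x : ZMod n => c.1 (x + k)) a b ↔
      WalkChord (walkOf c.1) (a + k) (b + k) := by
    intro a b
    refine ⟨fun h => ⟨by linarith [h.1], fun j h1 h2 => ?_, ?_⟩,
      fun h => ⟨by linarith [h.1], fun j h1 h2 => ?_, ?_⟩⟩
    · have := h.2.1 (j - k) (by omega) (by omega)
      rw [hs, hs, sub_add_cancel] at this
      omega
    · have := h.2.2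
      rw [hs, hs] at this
      omega
    · have := h.2.1 (j + k) (by omega) (by omega)
      rw [hs, hs]
      omega
    · have := h.2.2
      rw [hs, hs]
      omega
  ext α
  rw [Set.mem_smul_set]
  constructor
  · rintro ⟨_, ⟨a, ha, rfl⟩ | ⟨a, b, hab, rfl⟩, rfl⟩
    · refine Or.inl ⟨a - k, (spoke _).2 (by simpa using ha), ?_⟩
      change Arc.spoke (((sigma n) ^ k).1 _) = _
      rw [sigma_pow_apply]
      simp
    · refine Or.inr ⟨a - k, b - k, (chord _ _).2 (by simpa using hab), ?_⟩
      change Arc.chord (((sigma n) ^ k).1 _) (((sigma n) ^ k).1 _) = _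
      rw [sigma_pow_apply, sigma_pow_apply]
      simp
  · rintro (⟨a, ha, rfl⟩ | ⟨a, b, hab, rfl⟩)
    · refine ⟨_, Or.inl ⟨a + k, (spoke a).1 ha, rfl⟩, ?_⟩
      change Arc.spoke (((sigma n) ^ k).1 _) = _
      rw [sigma_pow_apply]
      simp
    · refine ⟨_, Or.inr ⟨a + k, b + k, (chord a b).1 hab, rfl⟩, ?_⟩
      change Arc.chord (((sigma n) ^ k).1 _) (((sigma n) ^ k).1 _) = _
      rw [sigma_pow_apply, sigma_pow_apply]
      simp

/-! ### Counting the fixed triangulations -/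

/-- Stars and bars for each value of the sum. -/
theorem card_degreeSequence [NeZero n] : Nat.card (DegreeSequence n) =
    ∑ u ∈ Finset.range n, (n - 1 + u).choose (n - 1) := by
  classical
  let e : DegreeSequence n ≃ Σ j : Fin n, {c : ZMod n → ℕ // ∑ x, c x = j} :=
    { toFun := fun c => ⟨⟨_, c.2⟩, ⟨c.1, rfl⟩⟩
      invFun := fun x => ⟨x.2.1, by rw [x.2.2]; exact x.1.2⟩
      left_inv := fun c => rfl
      right_inv := by
        rintro ⟨⟨j, hj⟩, ⟨c, hc⟩⟩
        simp only at hc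
        subst hc
        rfl }
  have hn := NeZero.pos n
  have hfin : ∀ j : Fin n, Finite {c : ZMod n → ℕ // ∑ x, c x = j} := fun j =>
    Finite.of_equiv _ (Sym.equivNatSumOfFintype (ZMod n) j)
  rw [Nat.card_congr e, Nat.card_sigma, ← Fin.sum_univ_eq_sum_range
    (fun u => (n - 1 + u).choose (n - 1))]
  refine Finset.sum_congr rfl fun j _ => ?_
  rw [← Nat.card_congr (Sym.equivNatSumOfFintype (ZMod n) j), Nat.card_eq_fintype_card,
    Sym.card_sym_eq_choose, ZMod.card, Nat.sub_add_comm hn, Nat.choose_symm_add]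

theorem sum_range_mul_mod {g : ℕ} (f : ℕ → ℕ) (hf : ∀ i, f (i + g) = f i) (m : ℕ) :
    ∑ i ∈ Finset.range (m * g), f i = m * ∑ i ∈ Finset.range g, f i := by
  have hp : ∀ m i, f (m * g + i) = f i := by
    intro m i
    induction m with
    | zero => simp
    | succ m ih => rw [← ih, ← hf (m * g + i)]; congr 1; ring
  induction m with
  | zero => simp
  | succ m ih =>
    rw [add_mul, one_mul, Finset.sum_range_add, ih]
    simp only [hp]
    ring

theorem sum_comp_castHom {g m : ℕ} [NeZero g] [NeZero (m * g)] (c : ZMod g → ℕ) :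
    ∑ x : ZMod (m * g), c (ZMod.castHom (Nat.dvd_mul_left g m) (ZMod g) x) = m * ∑ x, c x := by
  rw [ZMod.sum_eq_sum_range, ZMod.sum_eq_sum_range, ← sum_range_mul_mod]
  · simp
  · intro i
    simp

/-- By Bézout a period `k` modulo `m * g` yields the period `g`, so the sequence descends to `ZMod
g`. Pulling back multiplies the sum by `m`, which matches the bounds `m * g` and `g`. -/
theorem card_shift_fixed {g m : ℕ} [NeZero g] [NeZero (m * g)] (k : ℕ)
    (hk : (m * g).gcd k = g) :
    Nat.card {c : DegreeSequence (m * g) // c.shift k = c} = Nat.card (DegreeSequence g) := by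
  have hm : 0 < m := Nat.pos_of_ne_zero fun h => NeZero.ne (m * g) (by rw [h, zero_mul])
  set π := ZMod.castHom (Nat.dvd_mul_left g m) (ZMod g) with hπ
  have hkg : ((k : ℕ) : ZMod g) = 0 := (ZMod.natCast_eq_zero_iff k g).2 (hk ▸ Nat.gcd_dvd_right _ _)
  have hsum : ∀ c : ZMod g → ℕ, ∑ x, c (π x) < m * g ↔ ∑ x, c x < g := fun c => by
    rw [sum_comp_castHom]
    exact Nat.mul_lt_mul_left hm
  refine (Nat.card_congr (Equiv.ofBijective (fun c : DegreeSequence g =>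
    (⟨⟨fun x => c.1 (π x), (hsum c.1).2 c.2⟩, Subtype.ext (funext fun x => ?_)⟩ :
      {c : DegreeSequence (m * g) // c.shift k = c})) ⟨?_, ?_⟩)).symm
  · simp [DegreeSequence.shift, hkg]
  · intro c c' h
    refine Subtype.ext (funext fun x => ?_)
    obtain ⟨y, rfl⟩ := ZMod.castHom_surjective (Nat.dvd_mul_left g m) x
    exact congrFun (congrArg (fun c => c.1.1) h) y
  · rintro ⟨c, hc⟩
    have hc' : Function.Periodic c.1 (k : ZMod (m * g)) := fun x =>
      congrFun (congrArg Subtype.val hc) x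
    have hg : Function.Periodic c.1 (g : ZMod (m * g)) := by
      have e : ((g : ℤ) : ZMod (m * g)) = Nat.gcdB (m * g) k * (k : ZMod (m * g)) := by
        have := congrArg (Int.cast (R := ZMod (m * g))) (Nat.gcd_eq_gcd_ab (m * g) k)
        rw [hk] at this
        rw [this]
        push_cast
        have h0 : (m : ZMod (m * g)) * g = 0 := by exact_mod_cast ZMod.natCast_self (m * g)
        rw [h0]
        ring
      rw [Int.cast_natCast] at e
      rw [e]
      exact hc'.int_mul _
    have key : ∀ x, c.1 ((π x).val : ZMod (m * g)) = c.1 x := by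
      intro x
      obtain ⟨a, rfl⟩ := ZMod.intCast_surjective x
      obtain ⟨l, hl⟩ := (intCast_eq_intCast_iff_exists (n := g) a ((a : ZMod g).val : ℤ)).1 (by simp)
      have := hg.int_mul l (a : ZMod (m * g))
      rw [hπ, map_intCast, ← this]
      refine congrArg c.1 ?_
      exact_mod_cast congrArg (Int.cast (R := ZMod (m * g))) hl
    refine ⟨⟨fun x => c.1 (x.val : ZMod (m * g)), (hsum _).1 ?_⟩, ?_⟩
    · simp only [key]
      exact c.2
    · exact Subtype.ext (Subtype.ext (funext key))

theorem card_fixedBy_sigma_pow [NeZero n] (k : ℕ) :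
    Nat.card (MulAction.fixedBy (Triangulation n) ((sigma n) ^ k)) =
      Nat.card {c : DegreeSequence n // c.shift k = c} := by
  have hb : Function.Bijective (triangulationOf (n := n)) :=
    ⟨triangulationOf_injective, triangulationOf_surjective⟩
  refine (Nat.card_congr ((Equiv.ofBijective _ hb).subtypeEquiv fun c => ?_)).symm
  change _ ↔ triangulationOf c ∈ _
  rw [MulAction.mem_fixedBy, sigma_pow_smul_triangulationOf,
    triangulationOf_injective.eq_iff]

/-! ### Finiteness, the order of the rotation and the sieving statement -/

instance [NeZero n] : Finite (Arc n) :=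
  Finite.of_surjective (fun x : ZMod n ⊕ ZMod n × ZMod n =>
    Sum.elim Arc.spoke (fun p => Arc.chord p.1 p.2) x) (by
      rintro (i | ⟨i, j⟩)
      · exact ⟨Sum.inl i, rfl⟩
      · exact ⟨Sum.inr (i, j), rfl⟩)

theorem orderOf_sigma (n : ℕ) : orderOf (sigma n) = n := by
  refine dvd_antisymm (orderOf_dvd_of_pow_eq_one (Subtype.ext (Equiv.ext fun i => ?_))) ?_
  · rw [sigma_pow_apply]
    simp
  · have h := sigma_pow_apply (n := n) (orderOf (sigma n)) 0
    rw [pow_orderOf_eq_one, zero_sub] at h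
    have : ((orderOf (sigma n) : ℕ) : ZMod n) = 0 := neg_eq_zero.1 h.symm
    exact (ZMod.natCast_eq_zero_iff _ _).1 this

end PuncturedPolygon

theorem proposition3p9 (n : ℕ) (hn : 1 ≤ n) :
    CyclicSieving n (PuncturedPolygon.Triangulation n) (PuncturedPolygon.RotationGroup n)
      (PuncturedPolygon.sigma n) (tPoly n) := by
  have : NeZero n := ⟨by omega⟩
  refine ⟨?_, ?_, PuncturedPolygon.orderOf_sigma n, fun ζ hζ k => ?_⟩
  · unfold PuncturedPolygon.Triangulation
    infer_instance
  · rintro ⟨g, hg⟩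
    obtain ⟨k, rfl⟩ := Subgroup.mem_zpowers_iff.1 hg
    exact Subgroup.mem_zpowers_iff.2 ⟨k, Subtype.ext rfl⟩
  · have hprim : IsPrimitiveRoot (ζ ^ k) (n / n.gcd k) := by
      rcases Nat.eq_zero_or_pos k with rfl | hk
      · rw [pow_zero, Nat.gcd_zero_right, Nat.div_self hn]
        exact IsPrimitiveRoot.one
      · rw [hζ.eq_orderOf, ← orderOf_pow' _ hk.ne']
        exact IsPrimitiveRoot.orderOf _
    obtain ⟨m, hm⟩ := Nat.gcd_dvd_left n k
    have hg0 : 0 < n.gcd k := Nat.gcd_pos_of_pos_left k hn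
    generalize hg : n.gcd k = g at *
    rw [mul_comm] at hm
    subst hm
    have : NeZero g := ⟨hg0.ne'⟩
    rw [Nat.mul_div_cancel _ hg0] at hprim
    have hm0 : 0 < m := Nat.pos_of_mul_pos_right hn
    rw [PuncturedPolygon.card_fixedBy_sigma_pow, PuncturedPolygon.card_shift_fixed k hg,
      PuncturedPolygon.card_degreeSequence, mul_comm m g, hprim.aeval_tPoly hm0 hg0]
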